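/- **Setting.** Let $\delta>0$, $D=(0,1]^2$, $\mathcal U=(0,1]\times(-\delta,0]$, with periodic boundary conditions at $x=0$, $x=1$ (functions are extended $1$-periodically in $x$, and $\mathcal U$ is regarded as a strip whose vertical sides are glued). Let $h=1/N$ with $N\ge 1$ an integer, $D_h=D\cap h\mathbb Z^2$ and $\mathcal U_h=\mathcal U\cap h\mathbb Z^2$. **Boundary data.** For $s>0$ write $s=k+\alpha$ with $k\in\mathbb N_0$, $0<\alpha\le1$, and let $W^{s,\infty}=C^{k,\alpha}$ (derivatives up to order $k$ bounded, those of order $k$ $\alpha$-Hölder); $W^{0,\infty}$ is the space of bounded functions. Let $M\ge1$, $0<x_1<\dots<x_M\le1$, $L>0$, $T_i=\{(x,y): -\delta\le y\le -L|x-x_i|\}$ (taken periodically in $x$), and let $U_i$ be the part of $\mathcal U$ between $T_{i-1}$ and $T_i$, where $T_0:=T_M$. Let $s>0$, $0\le s'\le s$, and let $u_0:\mathcal U\to\mathbb R$ satisfy $u_0\in W^{s',\infty}(\mathcal U)$ and $u_0\in W^{s,\infty}(U_i)$ for $1\le i\le M$. **The method.** Let $r\ge1$ with $h<\delta/(r+2)$,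 let $A\subset\mathbb R^2$ be a finite set contained in the closed disc of radius $r$ about $0$, and let $\hat w\ge0$ be a weight function. Put $w_r(y)=\hat w(y/r)$ and $$a_r^*=(A\setminus\{0\})\cap\{y_2\le c\},\qquad c=-1\ \text{(direct form)},\quad c=0\ \text{(semi-implicit form)}.$$ The inpainted image $u_h$ equals $u_0$ on $\mathcal U_h$, is periodic in $x$, and $D_h$ is filled row by row from the bottom by $$u_h(\mathbf x)=\frac{\sum_{y\in a_r^*}w_r(y)\,u_h(\mathbf x+hy)}{\sum_{y\in a_r^*}w_r(y)},\qquad \mathbf x\in D_h,$$ where values at points off the lattice $h\mathbb Z^2$ are defined by bilinear interpolation; in the direct form only previously filled rows enter, in the semi-implicit form this is a linear system for the values in the current row. Assume $\sum_{y\in a_r^*}w_r(y)>0$, let $$g_r^*=\frac{\sum_{y\in a_r^*}w_r(y)\,y}{\sum_{y\in a_r^*}w_r(y)}$$ be the centre of mass of the stencil, and assume $g_r^*\cdot e_2\ne0$. Let $\theta_r^*\in(0,\pi)$ be the counter-clockwise angle from the $x$-axis to the line spanned by $g_r^*$, and let $$u(\mathbf x)=u_0(\Pi_{\theta_r^*}(\mathbf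 x)),\qquad \Pi_\theta(x,y)=(x-y\cot\theta \bmod 1,\;0),$$ be the weak solution of $\nabla u\cdot g_r^*=0$ in $D$, $u|_{y=0}=u_0|_{y=0}$, $u|_{x=0}=u|_{x=1}$. For $f:D_h\to\mathbb R$ let $\|f\|_p=\big(\sum_{\mathbf x\in D_h}|f(\mathbf x)|^ph^2\big)^{1/p}$ for $0<p<\infty$ and $\|f\|_\infty=\max_{D_h}|f|$. **Theorem.** The image $u_h$ exists and is unique, and for every $p\in(0,\infty]$ (with $1/\infty:=0$) $$\|u-u_h\|_p\le K\cdot(rh)^{\left(\frac{s'}2+\frac1{2p}\right)\wedge\frac s2\wedge1},\qquad K=K\!\left(\frac{r}{|g_r^*\cdot e_2|},\theta_r^*\right),$$ where the function $K:(0,\infty)\times(0,\pi)\to\mathbb R$ depends only on $u_0,\delta,L,(x_i),s,s'$ (not on $p$, $h$, nor otherwise on $r$, $A$, $\hat w$ or the form of the method). Moreover $K$ can be chosen continuous, strictly increasing in its first argument $r/|g_r^*\cdot e_2|$, and such that, for each fixed first argument, $K\to\infty$ as $\theta_r^*\to0$ or $\theta_r^*\to\pi$. -/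

import Mathlib

open Set Filter Topology
open scoped ENNReal

noncomputable section

namespace Inpainting

/-! ### Function spaces and boundary data

Data that are periodic in the horizontal variable are represented by functions on `ℝ × ℝ` that are
1-periodic in the first variable; subsets of the strip `(0,1] × (-δ,0]`, whose sides are glued,
are represented by their lifts to `ℝ × (-δ,0]`. -/

/-- `u ∈ W^{s,∞}(S)` for a convex set `S` with non-empty interior, as a condition on a function
that is defined pointwise: bounded functions if `s = 0`; if `s > 0`, the Hölder class `C^{k,α}(S)`
with `s = k + α`, `k ∈ ℕ` and `0 < α ≤ 1` (so that `W^{k+1,∞} = C^{k,1}`), all derivatives of order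
at most `k` being bounded. -/
def MemSobolevInf (s : ℝ) (S : Set (ℝ × ℝ)) (u : ℝ × ℝ → ℝ) : Prop :=
  (∃ C, ∀ p ∈ S, |u p| ≤ C) ∧
  (0 < s → ∃ (k : ℕ) (α : ℝ), s = k + α ∧ 0 < α ∧ α ≤ 1 ∧
    ContDiffOn ℝ k u S ∧
    ∃ C, (∀ j ≤ k, ∀ p ∈ S, ‖iteratedFDerivWithin ℝ j u S p‖ ≤ C) ∧
      ∀ p ∈ S, ∀ q ∈ S,
        ‖iteratedFDerivWithin ℝ k u S p - iteratedFDerivWithin ℝ k u S q‖ ≤ C * ‖p - q‖ ^ α)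

/-- The (lifted) undamaged region `𝒰`. -/
def undamaged (δ : ℝ) : Set (ℝ × ℝ) := {p | -δ < p.2 ∧ p.2 ≤ 0}

/-- The closed triangle with tip `(a, 0)` and sides of slope `± L`. -/
def triangle (δ L a : ℝ) : Set (ℝ × ℝ) := {p | -δ ≤ p.2 ∧ p.2 ≤ 0 ∧ p.2 ≤ -L * |a - p.1|}

/-- The tip to the left of the tip `x i`, cyclically: the tip to the left of the first one is the
last one, shifted by one period. -/
def leftTip {M : ℕ} [NeZero M] (x : Fin M → ℝ) (i : Fin M) : ℝ :=
  if i = 0 then x (i - 1) - 1 else x (i - 1)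

/-- The part `U_i` of the undamaged region between the `i`-th triangle and the one to its left. -/
def between {M : ℕ} [NeZero M] (δ L : ℝ) (x : Fin M → ℝ) (i : Fin M) : Set (ℝ × ℝ) :=
  {p ∈ undamaged δ | leftTip x i < p.1 ∧ p.1 < x i} \
    (triangle δ L (leftTip x i) ∪ triangle δ L (x i))

/-! ### The inpainting algorithm

Pixels are indexed by `ℤ × ℤ`: with pixel width `h = 1 / N` the pixel `(j, m)` sits at
`(j h, m h)`. Points between pixels are given in pixel units. -/

/-- Value at a point (a ghost pixel if it is not a pixel) by bilinear interpolation. -/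
def bilinear (v : ℤ × ℤ → ℝ) (p : ℝ × ℝ) : ℝ :=
  (1 - Int.fract p.1) * (1 - Int.fract p.2) * v (⌊p.1⌋, ⌊p.2⌋)
    + Int.fract p.1 * (1 - Int.fract p.2) * v (⌊p.1⌋ + 1, ⌊p.2⌋)
    + (1 - Int.fract p.1) * Int.fract p.2 * v (⌊p.1⌋, ⌊p.2⌋ + 1)
    + Int.fract p.1 * Int.fract p.2 * v (⌊p.1⌋ + 1, ⌊p.2⌋ + 1)

/-- The discrete inpainting domain `D_h^{(k)}` that is left after the `k` lowest rows have been
filled (onion shell order). -/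
def unfilledPixels (N k : ℕ) : Set (ℤ × ℤ) := {z | (k : ℤ) < z.2 ∧ z.2 ≤ N}

/-- The continuous inpainting domain `D^{(k)}`, in pixel units: the points of the image domain at
sup-distance less than one pixel from `D_h^{(k)}`. -/
def unfilledRegion (N k : ℕ) : Set (ℝ × ℝ) :=
  {p | p.2 ≤ N ∧ ∃ z ∈ unfilledPixels N k, |(z.1 : ℝ) - p.1| < 1 ∧ |(z.2 : ℝ) - p.2| < 1}

/-- `Ω \ D^{(k)}`, in pixel units. -/
def readable (N k : ℕ) : Set (ℝ × ℝ) := {p | p.2 ≤ N} \ unfilledRegion N k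

open Classical in
/-- The update formula: the weighted average of `v` over those points of the punctured
neighbourhood `z + A` that lie in `R`. The offsets `A` are in pixel units and `w` is the profile
of the weights, a function of the offset divided by the radius `r`. -/
def update (r : ℝ) (A : Finset (ℝ × ℝ)) (w : ℝ × ℝ → ℝ) (R : Set (ℝ × ℝ)) (v : ℤ × ℤ → ℝ)
    (z : ℤ × ℤ) : ℝ :=
  (∑ y ∈ A with y ≠ 0 ∧ ((z.1 : ℝ), (z.2 : ℝ)) + y ∈ R,
      w (r⁻¹ • y) * bilinear v (((z.1 : ℝ), (z.2 : ℝ)) + y)) /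
    ∑ y ∈ A with y ≠ 0 ∧ ((z.1 : ℝ), (z.2 : ℝ)) + y ∈ R, w (r⁻¹ • y)

/-- The damaged image: the data on and below the row `0`, and `0` on the inpainting domain. -/
def damagedImage (N : ℕ) (u₀ : ℝ × ℝ → ℝ) (z : ℤ × ℤ) : ℝ :=
  if z.2 ≤ 0 then u₀ ((z.1 : ℝ) / N, (z.2 : ℝ) / N) else 0

/-- The two forms of the algorithm. -/
inductive Method
  | direct
  | semiImplicit

/-- One step, from the image `v` in which the rows up to `k` are known to the image `v'` in which
the row `k + 1` is filled too. In the direct form the new values are averages of values known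
before the step; in the semi-implicit form they solve the linear system in which the averages also
involve the unknown values in the current row. -/
def Step (method : Method) (N : ℕ) (r : ℝ) (A : Finset (ℝ × ℝ)) (w : ℝ × ℝ → ℝ) (k : ℕ)
    (v v' : ℤ × ℤ → ℝ) : Prop :=
  (∀ z : ℤ × ℤ, z.2 ≠ k + 1 → v' z = v z) ∧
  ∀ z : ℤ × ℤ, z.2 = k + 1 → v' z =
    match method with
    | .direct => update r A w (readable N k) v z
    | .semiImplicit => update r A w (readable N (k + 1)) v' z

/-- `u` is the image that the algorithm produces, with periodic boundary conditions at the sides of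
the unit square. -/
def IsInpainted (method : Method) (N : ℕ) (r : ℝ) (A : Finset (ℝ × ℝ)) (w : ℝ × ℝ → ℝ)
    (u₀ : ℝ × ℝ → ℝ) (u : ℤ × ℤ → ℝ) : Prop :=
  ∃ v : ℕ → ℤ × ℤ → ℝ, v 0 = damagedImage N u₀ ∧
    (∀ k ≤ N, ∀ z : ℤ × ℤ, v k (z.1 + N, z.2) = v k z) ∧
    (∀ k < N, Step method N r A w k (v k) (v (k + 1))) ∧
    u = v N

open Classical in
/-- The stencil `a_r^*`. -/
def stencil (method : Method) (A : Finset (ℝ × ℝ)) : Finset (ℝ × ℝ) :=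
  match method with
  | .direct => {y ∈ A | y ≠ 0 ∧ y.2 ≤ -1}
  | .semiImplicit => {y ∈ A | y ≠ 0 ∧ y.2 ≤ 0}

/-- The total mass of the stencil weights. -/
def totalMass (method : Method) (r : ℝ) (A : Finset (ℝ × ℝ)) (w : ℝ × ℝ → ℝ) : ℝ :=
  ∑ y ∈ stencil method A, w (r⁻¹ • y)

/-- The centre of mass `g_r^*` of the stencil with respect to the stencil weights. -/
def centerOfMass (method : Method) (r : ℝ) (A : Finset (ℝ × ℝ)) (w : ℝ × ℝ → ℝ) : ℝ × ℝ :=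
  (totalMass method r A w)⁻¹ • ∑ y ∈ stencil method A, w (r⁻¹ • y) • y

/-! ### The continuum limit and the error -/

/-- The counter-clockwise angle in `[0, π)` from the `x`-axis to the line spanned by `g`. -/
def lineAngle (g : ℝ × ℝ) : ℝ := toIcoMod Real.pi_pos 0 (Complex.arg ⟨g.1, g.2⟩)

/-- The transport operator `Π_θ`; the first coordinate is reduced modulo `1` to `(0,1]`. -/
def transport (θ : ℝ) (p : ℝ × ℝ) : ℝ × ℝ :=
  (toIocMod one_pos 0 (p.1 - Real.cot θ * p.2), 0)

/-- The pixels of the inpainting domain `D_h`. -/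
def pixels (N : ℕ) : Finset (ℤ × ℤ) := Finset.Icc 1 (N : ℤ) ×ˢ Finset.Icc 1 (N : ℤ)

/-- The discrete `L^p` norm on `D_h`, for `0 < p ≤ ∞`. -/
def discreteNorm (N : ℕ) (p : ℝ≥0∞) (f : ℤ × ℤ → ℝ) : ℝ :=
  if p = ∞ then (((pixels N).sup fun z => ‖f z‖₊ : NNReal) : ℝ)
  else (∑ z ∈ pixels N, |f z| ^ p.toReal * (1 / (N : ℝ)) ^ 2) ^ (1 / p.toReal)

end Inpainting

end

/-!
Filling a row replaces each value by an average over a stencil, so the inpainted image is discrete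
harmonic for this average. The stencil reproduces affine functions of the foot of the characteristic
through a pixel, because its centre of mass spans the characteristic direction. Subtracting from the
image the first order Taylor polynomial of the data at the foot `a` of a given pixel leaves a
harmonic function that has to be estimated at that pixel from its values in the `r` lowest rows.

A walk along the stencil that starts at the pixel leaves the domain at distance of order `√(r h)`
from `a`, since it makes at most of order `1 / (r h)` effective steps of size `r h`. The analytic
form of this remark is an exponential barrier at scale `√(r h)`, uniform for `r / |g₂| ≤ Λ`. Hence
the error is of order `(r h) ^ (s / 2)`, or `(r h) ^ (s' / 2)` in boundary layers of width `√(r h)`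
around the characteristics that emanate from the tips. The area of these layers, raised to the power
`1 / p`, accounts for the gain of `1 / (2 p)` in the exponent. Finally, a continuous, increasing
majorant of the constants for `Λ = 1, 2, …` plus `1 / sin θ` serves as `K`.
-/

namespace Inpainting

/-! ### Averages over a stencil -/

section Bilinear

variable (v v' : ℤ × ℤ → ℝ) (p : ℝ × ℝ)

theorem bilinear_add : bilinear (v + v') p = bilinear v p + bilinear v' p := by
  simp only [bilinear, Pi.add_apply]; ring

theorem bilinear_smul (c : ℝ) : bilinear (c • v) p = c • bilinear v p := by
  simp only [bilinear, Pi.smul_apply, smul_eq_mul]; ring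

theorem bilinear_affine (a b c : ℝ) :
    bilinear (fun z ↦ a + b * z.1 + c * z.2) p = a + b * p.1 + c * p.2 := by
  simp only [bilinear]
  push_cast
  linear_combination b * Int.floor_add_fract p.1 + c * Int.floor_add_fract p.2

theorem abs_floor_sub_lt_one (t : ℝ) : |(⌊t⌋ : ℝ) - t| < 1 := by
  rw [abs_sub_comm, Int.self_sub_floor, Int.abs_fract]
  exact Int.fract_lt_one t

theorem abs_floor_add_one_sub_lt_one {t : ℝ} (ht : Int.fract t ≠ 0) :
    |((⌊t⌋ + 1 : ℤ) : ℝ) - t| < 1 := by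
  have hpos : 0 < Int.fract t := (Int.fract_nonneg t).lt_of_ne' ht
  have hfloor := Int.floor_add_fract t
  have hlt := Int.lt_floor_add_one t
  push_cast
  exact abs_lt.2 ⟨by linarith, by linarith⟩

variable {v v' p}

theorem bilinear_mono
    (h : ∀ z : ℤ × ℤ, |(z.1 : ℝ) - p.1| < 1 → |(z.2 : ℝ) - p.2| < 1 → v z ≤ v' z) :
    bilinear v p ≤ bilinear v' p := by
  have mul_le {c : ℝ} {z : ℤ × ℤ} (hc : 0 ≤ c)
      (hz : c ≠ 0 → |(z.1 : ℝ) - p.1| < 1 ∧ |(z.2 : ℝ) - p.2| < 1) : c * v z ≤ c * v' z := by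
    rcases eq_or_ne c 0 with rfl | h0
    · simp only [zero_mul, le_refl]
    · exact mul_le_mul_of_nonneg_left (h z (hz h0).1 (hz h0).2) hc
  have low := abs_floor_sub_lt_one
  have high {t : ℝ} := abs_floor_add_one_sub_lt_one (t := t)
  have fract_nonneg := Int.fract_nonneg (R := ℝ)
  have compl_nonneg (t : ℝ) : 0 ≤ 1 - Int.fract t := sub_nonneg.2 (Int.fract_lt_one t).le
  refine add_le_add (add_le_add (add_le_add ?_ ?_) ?_) ?_
  · exact mul_le (mul_nonneg (compl_nonneg _) (compl_nonneg _)) fun _ ↦ ⟨low _, low _⟩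
  · exact mul_le (mul_nonneg (fract_nonneg _) (compl_nonneg _)) fun h0 ↦
      ⟨high (left_ne_zero_of_mul h0), low _⟩
  · exact mul_le (mul_nonneg (compl_nonneg _) (fract_nonneg _)) fun h0 ↦
      ⟨low _, high (right_ne_zero_of_mul h0)⟩
  · exact mul_le (mul_nonneg (fract_nonneg _) (fract_nonneg _)) fun h0 ↦
      ⟨high (left_ne_zero_of_mul h0), high (right_ne_zero_of_mul h0)⟩

end Bilinear

/-- The operator that replaces each pixel value by the weighted average of the interpolated image
over the translate of the stencil `S` to that pixel. -/
noncomputable def average (S : Finset (ℝ × ℝ)) (ω : ℝ × ℝ → ℝ) :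
    (ℤ × ℤ → ℝ) →ₗ[ℝ] ℤ × ℤ → ℝ where
  toFun v z := S.centerMass ω fun y ↦ bilinear v (((z.1 : ℝ), (z.2 : ℝ)) + y)
  map_add' v v' := by
    ext z
    simp only [Finset.centerMass, bilinear_add, smul_add, Finset.sum_add_distrib, Pi.add_apply]
  map_smul' c v := by
    ext z
    simp only [Finset.centerMass, bilinear_smul, smul_comm _ c, ← Finset.smul_sum, Pi.smul_apply,
      RingHom.id_apply]

/-- A weighted stencil of radius at most `r` that reaches backwards only and whose centre of mass
lies strictly behind its tip; this is all that the analysis uses of the two forms of the method. -/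
structure Admissible (r : ℝ) (S : Finset (ℝ × ℝ)) (ω : ℝ × ℝ → ℝ) : Prop where
  one_le : 1 ≤ r
  nonneg : ∀ y ∈ S, 0 ≤ ω y
  mass_pos : 0 < ∑ y ∈ S, ω y
  abs_fst_le : ∀ y ∈ S, |y.1| ≤ r
  neg_le_snd : ∀ y ∈ S, -r ≤ y.2
  snd_nonpos : ∀ y ∈ S, y.2 ≤ 0
  drift : (S.centerMass ω id).2 < 0

/-- The Lipschitz constant, with respect to the values in one row, of the averages in that row. -/
noncomputable def contractionFactor (r : ℝ) (S : Finset (ℝ × ℝ)) (ω : ℝ × ℝ → ℝ) : ℝ :=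
  1 + (S.centerMass ω id).2 / (r + 1)

section Average

variable {r : ℝ} {S : Finset (ℝ × ℝ)} {ω : ℝ × ℝ → ℝ}

theorem average_apply (v : ℤ × ℤ → ℝ) (z : ℤ × ℤ) :
    average S ω v z = S.centerMass ω fun y ↦ bilinear v (((z.1 : ℝ), (z.2 : ℝ)) + y) := rfl

theorem average_affine (hW : ∑ y ∈ S, ω y ≠ 0) (a b c : ℝ) (z : ℤ × ℤ) :
    average S ω (fun z ↦ a + b * z.1 + c * z.2) z =
      a + b * (z.1 + (S.centerMass ω id).1) + c * (z.2 + (S.centerMass ω id).2) := by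
  have expand : ∑ y ∈ S, ω y * (a + b * (z.1 + y.1) + c * (z.2 + y.2)) =
      (a + b * z.1 + c * z.2) * ∑ y ∈ S, ω y + b * ∑ y ∈ S, ω y * y.1
        + c * ∑ y ∈ S, ω y * y.2 := by
    simp only [Finset.mul_sum, ← Finset.sum_add_distrib]
    exact Finset.sum_congr rfl fun y _ ↦ by ring
  simp only [average_apply, bilinear_affine, Finset.centerMass, Prod.fst_add, Prod.snd_add,
    Prod.smul_fst, Prod.smul_snd, Prod.fst_sum, Prod.snd_sum, smul_eq_mul, id_eq, expand]
  field_simp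
  ring

namespace Admissible

theorem average_mono (hS : Admissible r S ω) {v v' : ℤ × ℤ → ℝ} {z : ℤ × ℤ}
    (h : ∀ ζ : ℤ × ℤ, |(ζ.1 : ℝ) - z.1| < r + 1 → (z.2 : ℝ) - (r + 1) < ζ.2 → ζ.2 ≤ z.2 →
      v ζ ≤ v' ζ) : average S ω v z ≤ average S ω v' z := by
  refine mul_le_mul_of_nonneg_left (Finset.sum_le_sum fun y hy ↦ mul_le_mul_of_nonneg_left
    (bilinear_mono fun ζ h1 h2 ↦ ?_) (hS.nonneg y hy)) (inv_nonneg.2 hS.mass_pos.le)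
  have hy1 := abs_le.1 (hS.abs_fst_le y hy)
  have hy2 := hS.neg_le_snd y hy
  have hy3 := hS.snd_nonpos y hy
  simp only [Prod.fst_add, Prod.snd_add, abs_lt] at h1 h2
  refine h ζ (abs_lt.2 ⟨by linarith, by linarith⟩) (by linarith) (Int.lt_add_one_iff.1 ?_)
  exact_mod_cast (by linarith : (ζ.2 : ℝ) < z.2 + 1)

theorem average_congr (hS : Admissible r S ω) {v v' : ℤ × ℤ → ℝ} {z : ℤ × ℤ}
    (h : ∀ ζ : ℤ × ℤ, ζ.2 ≤ z.2 → v ζ = v' ζ) : average S ω v z = average S ω v' z :=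
  le_antisymm (hS.average_mono fun ζ _ _ h3 ↦ (h ζ h3).le)
    (hS.average_mono fun ζ _ _ h3 ↦ (h ζ h3).ge)

theorem neg_le_centerMass_snd (hS : Admissible r S ω) : -r ≤ (S.centerMass ω id).2 :=
  (convex_halfSpace_ge (LinearMap.snd ℝ ℝ ℝ).isLinear (-r)).centerMass_mem hS.nonneg hS.mass_pos
    hS.neg_le_snd

theorem abs_centerMass_fst_le (hS : Admissible r S ω) : |(S.centerMass ω id).1| ≤ r :=
  abs_le.2 <| ((convex_halfSpace_ge (LinearMap.fst ℝ ℝ ℝ).isLinear (-r)).inter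
    (convex_halfSpace_le (LinearMap.fst ℝ ℝ ℝ).isLinear r)).centerMass_mem hS.nonneg hS.mass_pos
    fun y hy ↦ abs_le.1 (hS.abs_fst_le y hy)

theorem contractionFactor_nonneg (hS : Admissible r S ω) : 0 ≤ contractionFactor r S ω := by
  have hr : 0 < r + 1 := by linarith [hS.one_le]
  have : -1 ≤ (S.centerMass ω id).2 / (r + 1) := by
    rw [le_div_iff₀ hr]; linarith [hS.neg_le_centerMass_snd]
  rw [contractionFactor]
  linarith

theorem contractionFactor_lt_one (hS : Admissible r S ω) : contractionFactor r S ω < 1 := by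
  have hr : 0 < r + 1 := by linarith [hS.one_le]
  rw [contractionFactor]
  linarith [div_neg_of_neg_of_pos hS.drift hr]

theorem neg_contractionFactor_mul_le_average (hS : Admissible r S ω) {F : ℤ × ℤ → ℝ} {c : ℝ}
    (hc : 0 ≤ c) {z : ℤ × ℤ}
    (hlow : ∀ ζ : ℤ × ℤ, (z.2 : ℝ) - (r + 1) < ζ.2 → ζ.2 < z.2 → 0 ≤ F ζ)
    (hrow : ∀ ζ : ℤ × ℤ, ζ.2 = z.2 → -c ≤ F ζ) :
    -(contractionFactor r S ω * c) ≤ average S ω F z := by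
  have hr : 0 < r + 1 := by linarith [hS.one_le]
  -- On the pixels that the stencil reads, `F` lies above the affine function of the row that is
  -- `-c` in the row of `z` and vanishes `r + 1` rows below it.
  have barrier : average S ω
      (fun ζ ↦ -c * (1 - z.2 / (r + 1)) + 0 * ζ.1 + -c / (r + 1) * ζ.2) z ≤ average S ω F z := by
    refine hS.average_mono fun ζ _ h2 h3 ↦ ?_
    have rewrite : -c * (1 - z.2 / (r + 1)) + 0 * ζ.1 + -c / (r + 1) * ζ.2 =
        -(c * ((r + 1 + (ζ.2 - z.2)) / (r + 1))) := by field_simp; ring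
    rw [rewrite]
    rcases h3.lt_or_eq with h | h
    · refine le_trans ?_ (hlow ζ h2 h)
      exact neg_nonpos.2 (mul_nonneg hc (div_nonneg (by linarith) hr.le))
    · simpa only [h, sub_self, add_zero, div_self hr.ne', mul_one] using hrow ζ h
  rw [average_affine hS.mass_pos.ne'] at barrier
  refine le_of_eq_of_le ?_ barrier
  rw [contractionFactor]
  field_simp
  ring

theorem nonneg_of_average_le_of_row (hS : Admissible r S ω) {F : ℤ × ℤ → ℝ} {m : ℤ}
    (hlow : ∀ ζ : ℤ × ℤ, (m : ℝ) - (r + 1) < ζ.2 → ζ.2 < m → 0 ≤ F ζ)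
    (hbdd : ∃ c, ∀ ζ : ℤ × ℤ, ζ.2 = m → -c ≤ F ζ)
    (hsuper : ∀ ζ : ℤ × ℤ, ζ.2 = m → average S ω F ζ ≤ F ζ) (z : ℤ × ℤ) (hz : z.2 = m) :
    0 ≤ F z := by
  obtain ⟨c, hc⟩ := hbdd
  set q := contractionFactor r S ω
  have hq : 0 ≤ q := hS.contractionFactor_nonneg
  have improve (n : ℕ) : ∀ ζ : ℤ × ℤ, ζ.2 = m → -(q ^ n * max c 0) ≤ F ζ := by
    induction n with
    | zero => exact fun ζ hζ ↦ by linarith [hc ζ hζ, le_max_left c 0]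
    | succ n ih =>
      intro ζ hζ
      rw [pow_succ', mul_assoc]
      exact (hS.neg_contractionFactor_mul_le_average (by positivity) (hζ ▸ hlow)
        fun ξ hξ ↦ ih ξ (hξ.trans hζ)).trans (hsuper ζ hζ)
  have lim : Tendsto (fun n : ℕ ↦ -(q ^ n * max c 0)) atTop (𝓝 0) := by
    simpa using ((tendsto_pow_atTop_nhds_zero_of_lt_one hq hS.contractionFactor_lt_one).mul_const
      (max c 0)).neg
  exact le_of_tendsto' lim fun n ↦ improve n z hz

theorem nonneg_of_average_le (hS : Admissible r S ω) {F : ℤ × ℤ → ℝ} {n : ℕ}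
    (hbd : ∀ z : ℤ × ℤ, -r < z.2 → z.2 ≤ 0 → 0 ≤ F z)
    (hbdd : ∃ c, ∀ z : ℤ × ℤ, 1 ≤ z.2 → z.2 ≤ n → -c ≤ F z)
    (hsuper : ∀ z : ℤ × ℤ, 1 ≤ z.2 → z.2 ≤ n → average S ω F z ≤ F z)
    {z : ℤ × ℤ} (hz : -r < z.2) (hzn : z.2 ≤ n) : 0 ≤ F z := by
  obtain ⟨c, hc⟩ := hbdd
  have rows (m : ℕ) (hm : m ≤ n) : ∀ z : ℤ × ℤ, -r < z.2 → z.2 ≤ m → 0 ≤ F z := by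
    induction m with
    | zero => exact fun z h1 h2 ↦ hbd z h1 (by simpa using h2)
    | succ m ih =>
      intro z h1 h2
      rcases h2.lt_or_eq with h | h
      · exact ih (by omega) z h1 (by push_cast at h; omega)
      · have hz1 : (1 : ℝ) ≤ z.2 := by rw [h]; push_cast; linarith [(m.cast_nonneg : (0 : ℝ) ≤ m)]
        push_cast at h
        exact hS.nonneg_of_average_le_of_row
          (fun ζ h3 h4 ↦ ih (by omega) ζ (by linarith) (by omega))
          ⟨c, fun ζ hζ ↦ hc ζ (by omega) (by omega)⟩
          (fun ζ hζ ↦ hsuper ζ (by omega) (by omega)) z rfl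
  exact rows n le_rfl z hz hzn

end Admissible

end Average

/-! ### Exponential barriers -/

/-- The horizontal position, for pixel width `h`, of the foot of the characteristic through the
pixel `z`, if the characteristics have slope `1 / c`. -/
noncomputable def foot (h c : ℝ) (z : ℤ × ℤ) : ℝ := h * (z.1 - c * z.2)

/-- The reciprocal of the slope of the line spanned by the centre of mass of a weighted stencil. -/
noncomputable def invSlope (S : Finset (ℝ × ℝ)) (ω : ℝ × ℝ → ℝ) : ℝ :=
  (S.centerMass ω id).1 / (S.centerMass ω id).2

/-- The rate of the exponential barriers, for stencils whose ratio of radius to vertical drift is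
at most `Λ` and whose radius is at most `δ` in absolute units. -/
noncomputable def rate (Λ δ : ℝ) : ℝ := 1 / (4 * Λ * (1 + Λ + √δ) ^ 2)

/-- The barrier around the position `a`: it grows exponentially, on the length scale `σ / κ`, with
the distance of the foot of the characteristic from `a`. The factor that depends on the row makes
it a strict supersolution at the places where `cosh` is curved. -/
noncomputable def barrier (κ σ h c a : ℝ) (z : ℤ × ℤ) : ℝ :=
  Real.exp (κ * (h * z.2)) * Real.cosh (κ * ((foot h c z - a) / σ))

theorem rate_pos {Λ : ℝ} (hΛ : 1 ≤ Λ) (δ : ℝ) : 0 < rate Λ δ := by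
  have := Real.sqrt_nonneg δ
  rw [rate]
  positivity

theorem rate_le_one {Λ : ℝ} (hΛ : 1 ≤ Λ) (δ : ℝ) : rate Λ δ ≤ 1 := by
  have hX : 1 ≤ (1 + Λ + √δ) ^ 2 := one_le_pow₀ (by linarith [Real.sqrt_nonneg δ])
  rw [rate, div_le_one (by positivity)]
  linarith [one_le_mul_of_one_le_of_one_le hΛ hX]

theorem rate_mul_le_one {Λ δ ε : ℝ} (hΛ : 1 ≤ Λ) (hε : ε ≤ δ) :
    rate Λ δ * (2 * √ε * (1 + Λ + √δ)) ≤ 1 := by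
  have hσ : √ε ≤ √δ := Real.sqrt_le_sqrt hε
  have hσ0 := Real.sqrt_nonneg ε
  have : 0 < 1 + Λ + √δ := by linarith
  rw [rate, one_div_mul_eq_div, div_le_one (by positivity)]
  calc 2 * √ε * (1 + Λ + √δ) ≤ 2 * (1 + Λ + √δ) * (1 + Λ + √δ) := by gcongr; linarith
    _ = 2 * 1 * (1 + Λ + √δ) ^ 2 := by ring
    _ ≤ 4 * Λ * (1 + Λ + √δ) ^ 2 := by gcongr; norm_num

theorem rate_mul_sq {Λ δ ε : ℝ} (hΛ : 1 ≤ Λ) (hε : 0 ≤ ε) :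
    rate Λ δ * (2 * √ε * (1 + Λ + √δ)) ^ 2 = ε / Λ := by
  have hX : 1 + Λ + √δ ≠ 0 := by linarith [Real.sqrt_nonneg δ]
  rw [rate, mul_pow, mul_pow, Real.sq_sqrt hε]
  field_simp
  norm_num

theorem slopes_mul_le {r h δ Λ c τ : ℝ} (hr : 1 ≤ r) (hh : 0 < h) (hrh : r * h ≤ δ)
    (hc : |c| ≤ Λ) (hτ : |τ| = 1) :
    (|τ * (h / √(r * h))| + |h - τ * (h / √(r * h)) * c|) * (r + 1) ≤
      2 * √(r * h) * (1 + Λ + √δ) := by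
  have hσσ := Real.mul_self_sqrt (by positivity : 0 ≤ r * h)
  have hσ0 : 0 < √(r * h) := Real.sqrt_pos.2 (by positivity)
  have hσδ : √(r * h) ≤ √δ := Real.sqrt_le_sqrt hrh
  set σ := √(r * h)
  have slope₁ : |τ * (h / σ)| = h / σ := by rw [abs_mul, hτ, one_mul, abs_of_pos (by positivity)]
  have slope₂ : |h - τ * (h / σ) * c| ≤ h + h / σ * Λ := by
    refine (abs_sub _ _).trans ?_
    rw [abs_mul, slope₁, abs_of_pos hh]
    gcongr
  have hΛ : 0 ≤ Λ := (abs_nonneg c).trans hc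
  rw [slope₁]
  calc (h / σ + |h - τ * (h / σ) * c|) * (r + 1)
      ≤ (h / σ + (h + h / σ * Λ)) * (r + 1) := by gcongr
    _ = (h * (r + 1)) * ((1 + Λ + σ) / σ) := by field_simp; ring
    _ ≤ (2 * (σ * σ)) * ((1 + Λ + √δ) / σ) :=
        mul_le_mul (by nlinarith) (by gcongr) (by positivity) (by positivity)
    _ = 2 * σ * (1 + Λ + √δ) := by field_simp

theorem exp_abs_le_two_mul_cosh (t : ℝ) : Real.exp |t| ≤ 2 * Real.cosh t := by
  rw [Real.cosh_eq, mul_div_cancel₀ _ two_ne_zero]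
  exact Real.exp_abs_le t

theorem exists_linear_le_add_cosh {k H : ℝ} (hk : 0 < k) (hH : 0 < H) (C : ℝ) :
    ∃ c, ∀ x : ℝ, C * (1 + |x|) ≤ c + H * Real.cosh (k * x) := by
  refine ⟨C + C ^ 2 / (H * k ^ 2), fun x ↦ ?_⟩
  have quadratic : (k * |x|) ^ 2 / 4 ≤ Real.cosh (k * x) := by
    have hexp := Real.quadratic_le_exp_of_nonneg (abs_nonneg (k * x))
    have hcosh := exp_abs_le_two_mul_cosh (k * x)
    rw [abs_mul, abs_of_pos hk] at hexp hcosh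
    linarith [mul_nonneg hk.le (abs_nonneg x)]
  have square : 0 ≤ H * ((k * |x|) ^ 2 / 4) - C * |x| + C ^ 2 / (H * k ^ 2) := by
    rw [show H * ((k * |x|) ^ 2 / 4) - C * |x| + C ^ 2 / (H * k ^ 2) =
      (H * k ^ 2 * |x| / 2 - C) ^ 2 / (H * k ^ 2) by field_simp; ring]
    positivity
  linarith [mul_le_mul_of_nonneg_left quadratic hH.le]

section Barrier

variable {κ σ h c a : ℝ} {z : ℤ × ℤ}

theorem barrier_nonneg : 0 ≤ barrier κ σ h c a z :=
  mul_nonneg (Real.exp_pos _).le (Real.cosh_pos _).le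

theorem exp_abs_foot_sub_le_mul_barrier (hκ : 0 ≤ κ) (hσ : 0 ≤ σ) {δ : ℝ} (hz : -δ ≤ h * z.2) :
    Real.exp (κ * (|foot h c z - a| / σ)) ≤ 2 * Real.exp (κ * δ) * barrier κ σ h c a z := by
  have hrow : 1 ≤ Real.exp (κ * δ) * Real.exp (κ * (h * z.2)) := by
    rw [← Real.exp_add, ← mul_add]
    exact Real.one_le_exp (mul_nonneg hκ (by linarith))
  have hcosh := exp_abs_le_two_mul_cosh (κ * ((foot h c z - a) / σ))
  rw [abs_mul, abs_div, abs_of_nonneg hκ, abs_of_nonneg hσ] at hcosh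
  calc _ ≤ 2 * Real.cosh (κ * ((foot h c z - a) / σ)) := hcosh
    _ ≤ _ := le_mul_of_one_le_right (by positivity) hrow
    _ = _ := by rw [barrier]; ring

theorem cosh_foot_sub_le_barrier (hκ : 0 ≤ κ) (hz : 0 ≤ h * z.2) :
    Real.cosh (κ / σ * (foot h c z - a)) ≤ barrier κ σ h c a z := by
  rw [barrier, div_mul_eq_mul_div, mul_div_assoc]
  exact le_mul_of_one_le_left (Real.cosh_pos _).le (Real.one_le_exp (mul_nonneg hκ hz))

theorem barrier_le_exp_one (hκ : 0 ≤ κ) (hκ1 : κ ≤ 1) (hz : h * z.2 ≤ 1) (hza : foot h c z = a) :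
    barrier κ σ h c a z ≤ Real.exp 1 := by
  rw [barrier, hza, sub_self, zero_div, mul_zero, Real.cosh_zero, mul_one, Real.exp_le_exp]
  exact (mul_le_of_le_one_right hκ hz).trans hκ1

end Barrier

namespace Admissible

variable {r : ℝ} {S : Finset (ℝ × ℝ)} {ω : ℝ × ℝ → ℝ}

theorem abs_invSlope_le (hS : Admissible r S ω) {Λ : ℝ} (hg : r ≤ Λ * |(S.centerMass ω id).2|) :
    |invSlope S ω| ≤ Λ := by
  rw [invSlope, abs_div, div_le_iff₀ (abs_pos.2 hS.drift.ne)]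
  exact hS.abs_centerMass_fst_le.trans hg

theorem average_foot (hS : Admissible r S ω) (h : ℝ) (z : ℤ × ℤ) :
    average S ω (foot h (invSlope S ω)) z = foot h (invSlope S ω) z := by
  have affine : foot h (invSlope S ω) =
      fun z : ℤ × ℤ ↦ 0 + h * (z.1 : ℝ) + (-(h * invSlope S ω)) * (z.2 : ℝ) := by
    ext z; rw [foot]; ring
  have hg := hS.drift.ne
  rw [affine, average_affine hS.mass_pos.ne', invSlope]
  field_simp
  ring

theorem average_exp_le (hS : Admissible r S ω) {a b c : ℝ} (hsmall : (|b| + |c|) * (r + 1) ≤ 1)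
    (hdrift : ((|b| + |c|) * (r + 1)) ^ 2 ≤
      -(b * (S.centerMass ω id).1 + c * (S.centerMass ω id).2)) (z : ℤ × ℤ) :
    average S ω (fun ζ ↦ Real.exp (a + b * ζ.1 + c * ζ.2)) z ≤
      Real.exp (a + b * z.1 + c * z.2) := by
  set E := Real.exp (a + b * z.1 + c * z.2) with hE
  set D := (|b| + |c|) * (r + 1) with hD
  -- Since `exp t ≤ 1 + t + t ^ 2` for `|t| ≤ 1`, the exponential lies below an affine function on
  -- the pixels that the stencil reads.
  have upper : average S ω (fun ζ ↦ Real.exp (a + b * ζ.1 + c * ζ.2)) z ≤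
      average S ω (fun ζ ↦ E * (1 + D ^ 2 - (b * z.1 + c * z.2)) + E * b * ζ.1 + E * c * ζ.2)
        z := by
    refine hS.average_mono fun ζ h1 h2 h3 ↦ ?_
    set t := b * (ζ.1 - z.1) + c * (ζ.2 - z.2) with ht
    have htD : |t| ≤ D := by
      have h3' : (ζ.2 : ℝ) ≤ z.2 := by exact_mod_cast h3
      have h4 : |(ζ.2 : ℝ) - z.2| ≤ r + 1 := abs_le.2 ⟨by linarith, by linarith [hS.one_le]⟩
      refine (abs_add_le _ _).trans ?_
      rw [abs_mul, abs_mul, hD, add_mul]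
      gcongr
    have hexp := (abs_le.1 (Real.abs_exp_sub_one_sub_id_le (htD.trans hsmall))).2
    have hsq : t ^ 2 ≤ D ^ 2 := sq_le_sq.2 (htD.trans (le_abs_self D))
    calc Real.exp (a + b * ζ.1 + c * ζ.2) = E * Real.exp t := by
          rw [hE, ← Real.exp_add]; congr 1; rw [ht]; ring
      _ ≤ E * (1 + t + D ^ 2) := by gcongr; linarith
      _ = _ := by rw [ht]; ring
  rw [average_affine hS.mass_pos.ne'] at upper
  refine upper.trans ?_
  linarith [mul_le_mul_of_nonneg_left hdrift (Real.exp_pos (a + b * z.1 + c * z.2)).le]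

theorem average_exp_foot_le (hS : Admissible r S ω) {Λ δ h : ℝ} (hΛ : 1 ≤ Λ) (hh : 0 < h)
    (hrh : r * h ≤ δ) (hg : r ≤ Λ * |(S.centerMass ω id).2|) (a : ℝ) {τ : ℝ} (hτ : |τ| = 1)
    (z : ℤ × ℤ) :
    average S ω (fun ζ ↦ Real.exp (rate Λ δ *
      (τ * ((foot h (invSlope S ω) ζ - a) / √(r * h)) + h * ζ.2))) z ≤
      Real.exp (rate Λ δ * (τ * ((foot h (invSlope S ω) z - a) / √(r * h)) + h * z.2)) := by
  set κ := rate Λ δ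
  set c := invSlope S ω with hc
  have hκ : 0 < κ := rate_pos hΛ δ
  have hr : 0 ≤ r := zero_le_one.trans hS.one_le
  have slopes := slopes_mul_le hS.one_le hh hrh (hS.abs_invSlope_le hg) hτ
  set σ := √(r * h)
  have affine (ζ : ℤ × ℤ) : κ * (τ * ((foot h c ζ - a) / σ) + h * ζ.2) =
      -(κ * (τ * (a / σ))) + κ * (τ * (h / σ)) * ζ.1 + κ * (h - τ * (h / σ) * c) * ζ.2 := by
    rw [foot]; ring
  have size : (|κ * (τ * (h / σ))| + |κ * (h - τ * (h / σ) * c)|) * (r + 1) ≤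
      κ * (2 * σ * (1 + Λ + √δ)) := by
    rw [abs_mul κ, abs_mul κ, abs_of_pos hκ, ← mul_add, mul_assoc]
    exact mul_le_mul_of_nonneg_left slopes hκ.le
  have drift : -(κ * (τ * (h / σ)) * (S.centerMass ω id).1 +
      κ * (h - τ * (h / σ) * c) * (S.centerMass ω id).2) = κ * (h * |(S.centerMass ω id).2|) := by
    have := hS.drift.ne
    rw [abs_of_neg hS.drift, hc, invSlope]
    field_simp
    ring
  simp only [affine]
  refine hS.average_exp_le (size.trans (rate_mul_le_one hΛ hrh)) ?_ z
  rw [drift]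
  calc _ ≤ (κ * (2 * σ * (1 + Λ + √δ))) ^ 2 := by gcongr
    _ = κ * (r * h / Λ) := by rw [mul_pow, sq κ, mul_assoc, rate_mul_sq hΛ (by positivity)]
    _ ≤ κ * (h * |(S.centerMass ω id).2|) := by
        refine mul_le_mul_of_nonneg_left ?_ hκ.le
        rw [div_le_iff₀ (by positivity)]
        linarith [mul_le_mul_of_nonneg_right hg hh.le]

theorem average_barrier_le (hS : Admissible r S ω) {Λ δ h : ℝ} (hΛ : 1 ≤ Λ) (hh : 0 < h)
    (hrh : r * h ≤ δ) (hg : r ≤ Λ * |(S.centerMass ω id).2|) (a : ℝ) (z : ℤ × ℤ) :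
    average S ω (barrier (rate Λ δ) √(r * h) h (invSlope S ω) a) z ≤
      barrier (rate Λ δ) √(r * h) h (invSlope S ω) a z := by
  set B : ℝ → ℤ × ℤ → ℝ := fun τ ζ ↦
    Real.exp (rate Λ δ * (τ * ((foot h (invSlope S ω) ζ - a) / √(r * h)) + h * ζ.2)) with hB
  have split : barrier (rate Λ δ) √(r * h) h (invSlope S ω) a = (1 / 2 : ℝ) • (B 1 + B (-1)) := by
    ext ζ
    simp only [barrier, hB, Real.cosh_eq, Pi.smul_apply, Pi.add_apply, smul_eq_mul, mul_add,
      Real.exp_add, one_mul, neg_mul, mul_neg]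
    ring
  have right := hS.average_exp_foot_le hΛ hh hrh hg a abs_one z
  have left := hS.average_exp_foot_le hΛ hh hrh hg a (τ := -1) (by rw [abs_neg, abs_one]) z
  rw [split, map_smul, map_add]
  simp only [Pi.smul_apply, Pi.add_apply, smul_eq_mul]
  linarith

theorem le_of_boundary (hS : Admissible r S ω) {Λ δ h G a : ℝ} {n : ℕ} (hΛ : 1 ≤ Λ)
    (hh : 0 < h) (hrh : r * h ≤ δ) (hn : n * h ≤ 1) (hg : r ≤ Λ * |(S.centerMass ω id).2|)
    (hG : 0 < G) {V : ℤ × ℤ → ℝ}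
    (hV : ∀ z : ℤ × ℤ, 1 ≤ z.2 → z.2 ≤ n → average S ω V z = V z)
    (hgrowth : ∃ C, ∀ z : ℤ × ℤ, 1 ≤ z.2 → z.2 ≤ n →
      V z ≤ C * (1 + |foot h (invSlope S ω) z - a|))
    (hbd : ∀ z : ℤ × ℤ, -r < z.2 → z.2 ≤ 0 →
      V z ≤ G * Real.exp (rate Λ δ * (|foot h (invSlope S ω) z - a| / √(r * h))))
    {z : ℤ × ℤ} (hz1 : 1 ≤ z.2) (hzn : z.2 ≤ n) (hza : foot h (invSlope S ω) z = a) :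
    V z ≤ 2 * Real.exp (1 + δ) * G := by
  set κ := rate Λ δ
  set σ := √(r * h)
  set B := barrier κ σ h (invSlope S ω) a
  have hκ0 : 0 < κ := rate_pos hΛ δ
  have hκ1 : κ ≤ 1 := rate_le_one hΛ δ
  have hr : 0 < r := zero_lt_one.trans_le hS.one_le
  have hδ : 0 ≤ δ := (by positivity : 0 ≤ r * h).trans hrh
  have hσ0 : 0 < σ := Real.sqrt_pos.2 (by positivity)
  have comparison : 0 ≤ 2 * G * Real.exp (κ * δ) * B z - V z := by
    refine hS.nonneg_of_average_le (F := (2 * G * Real.exp (κ * δ)) • B - V) (n := n)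
      (fun ζ h1 h2 ↦ sub_nonneg.2 ((hbd ζ h1 h2).trans ?_)) ?_ (fun ζ h1 h2 ↦ ?_) ?_ hzn
    · have := exp_abs_foot_sub_le_mul_barrier (c := invSlope S ω) (a := a) hκ0.le hσ0.le
        (by nlinarith : -δ ≤ h * ζ.2)
      simp only [Pi.smul_apply, smul_eq_mul]
      linarith [mul_le_mul_of_nonneg_left this hG.le]
    · obtain ⟨C, hC⟩ := hgrowth
      obtain ⟨b, hb⟩ := exists_linear_le_add_cosh (by positivity : 0 < κ / σ)
        (by positivity : 0 < 2 * G * Real.exp (κ * δ)) C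
      refine ⟨b, fun ζ h1 h2 ↦ ?_⟩
      have : (0 : ℝ) ≤ ζ.2 := by exact_mod_cast zero_le_one.trans h1
      have hcosh := mul_le_mul_of_nonneg_left (cosh_foot_sub_le_barrier (σ := σ)
        (c := invSlope S ω) (a := a) hκ0.le (by positivity : 0 ≤ h * ζ.2))
        (by positivity : 0 ≤ 2 * G * Real.exp (κ * δ))
      simp only [Pi.sub_apply, Pi.smul_apply, smul_eq_mul]
      linarith [hC ζ h1 h2, hb (foot h (invSlope S ω) ζ - a)]
    · rw [map_sub, map_smul]
      simp only [Pi.sub_apply, Pi.smul_apply, smul_eq_mul, hV ζ h1 h2]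
      gcongr
      exact hS.average_barrier_le hΛ hh hrh hg a ζ
    · have : (1 : ℝ) ≤ z.2 := by exact_mod_cast hz1
      linarith
  have height : h * z.2 ≤ 1 := by
    have : (z.2 : ℝ) ≤ n := by exact_mod_cast hzn
    nlinarith
  have hBz : B z ≤ Real.exp 1 := barrier_le_exp_one hκ0.le hκ1 height hza
  have hκδ : κ * δ ≤ δ := mul_le_of_le_one_left hδ hκ1
  calc V z ≤ 2 * G * Real.exp (κ * δ) * B z := sub_nonneg.1 comparison
    _ ≤ 2 * G * Real.exp δ * Real.exp 1 :=
        mul_le_mul (by gcongr) hBz barrier_nonneg (by positivity)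
    _ = 2 * Real.exp (1 + δ) * G := by rw [Real.exp_add]; ring

theorem abs_le_of_boundary (hS : Admissible r S ω) {Λ δ h G a : ℝ} {n : ℕ} (hΛ : 1 ≤ Λ)
    (hh : 0 < h) (hrh : r * h ≤ δ) (hn : n * h ≤ 1) (hg : r ≤ Λ * |(S.centerMass ω id).2|)
    (hG : 0 < G) {V : ℤ × ℤ → ℝ}
    (hV : ∀ z : ℤ × ℤ, 1 ≤ z.2 → z.2 ≤ n → average S ω V z = V z)
    (hgrowth : ∃ C, ∀ z : ℤ × ℤ, 1 ≤ z.2 → z.2 ≤ n →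
      |V z| ≤ C * (1 + |foot h (invSlope S ω) z - a|))
    (hbd : ∀ z : ℤ × ℤ, -r < z.2 → z.2 ≤ 0 →
      |V z| ≤ G * Real.exp (rate Λ δ * (|foot h (invSlope S ω) z - a| / √(r * h))))
    {z : ℤ × ℤ} (hz1 : 1 ≤ z.2) (hzn : z.2 ≤ n) (hza : foot h (invSlope S ω) z = a) :
    |V z| ≤ 2 * Real.exp (1 + δ) * G := by
  obtain ⟨C, hC⟩ := hgrowth
  refine abs_le'.2 ⟨?_, ?_⟩
  · exact hS.le_of_boundary hΛ hh hrh hn hg hG hV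
      ⟨C, fun ζ h1 h2 ↦ (le_abs_self _).trans (hC ζ h1 h2)⟩
      (fun ζ h1 h2 ↦ (le_abs_self _).trans (hbd ζ h1 h2)) hz1 hzn hza
  · exact hS.le_of_boundary (V := -V) hΛ hh hrh hn hg hG
      (fun ζ h1 h2 ↦ by rw [map_neg, Pi.neg_apply, Pi.neg_apply, hV ζ h1 h2])
      ⟨C, fun ζ h1 h2 ↦ (neg_le_abs _).trans (hC ζ h1 h2)⟩
      (fun ζ h1 h2 ↦ (neg_le_abs _).trans (hbd ζ h1 h2)) hz1 hzn hza

end Admissible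

/-! ### Well-posedness of the algorithm -/

/-- Images that are periodic in the horizontal direction, with period `N` pixels. -/
def HPeriodic (N : ℕ) (v : ℤ × ℤ → ℝ) : Prop := ∀ z : ℤ × ℤ, v (z.1 + N, z.2) = v z

namespace HPeriodic

variable {N : ℕ} {v : ℤ × ℤ → ℝ}

theorem eq_of_intCast_eq (hv : HPeriodic N v) {i j : ℤ} (m : ℤ) (h : (i : ZMod N) = j) :
    v (i, m) = v (j, m) := by
  obtain ⟨k, hk⟩ := (ZMod.intCast_eq_intCast_iff_dvd_sub i j N).1 h
  have periodic : Function.Periodic (fun j : ℤ ↦ v (j, m)) N := fun j ↦ hv (j, m)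
  calc v (i, m) = v (i + k * N, m) := (periodic.int_mul k i).symm
    _ = v (j, m) := by rw [mul_comm, ← hk, add_sub_cancel]

theorem eq_val (hv : HPeriodic N v) [NeZero N] (z : ℤ × ℤ) :
    v z = v ((z.1 : ZMod N).val, z.2) :=
  hv.eq_of_intCast_eq z.2 (by simp)

theorem exists_abs_le (hv : HPeriodic N v) [NeZero N] (a b : ℤ) :
    ∃ C, ∀ z : ℤ × ℤ, a ≤ z.2 → z.2 ≤ b → |v z| ≤ C := by
  refine ⟨∑ q ∈ (Finset.univ : Finset (ZMod N)) ×ˢ Finset.Icc a b, |v (q.1.val, q.2)|,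
    fun z h1 h2 ↦ ?_⟩
  rw [hv.eq_val z]
  exact Finset.single_le_sum (f := fun q : ZMod N × ℤ ↦ |v (q.1.val, q.2)|) (a := (↑z.1, z.2))
    (fun _ _ ↦ abs_nonneg _) (by simp [h1, h2])

theorem sub {v' : ℤ × ℤ → ℝ} (hv : HPeriodic N v) (hv' : HPeriodic N v') :
    HPeriodic N (v - v') := fun z ↦ congr_arg₂ (· - ·) (hv z) (hv' z)

theorem bilinear_add_natCast (hv : HPeriodic N v) (p : ℝ × ℝ) :
    bilinear v (p.1 + N, p.2) = bilinear v p := by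
  have shift (i m : ℤ) : v (i + N, m) = v (i, m) := hv (i, m)
  have shift_succ (i m : ℤ) : v (i + N + 1, m) = v (i + 1, m) := by rw [add_right_comm, shift]
  simp only [bilinear, Int.fract_add_natCast, Int.floor_add_natCast, shift, shift_succ]

theorem average (hv : HPeriodic N v) (S : Finset (ℝ × ℝ)) (ω : ℝ × ℝ → ℝ) :
    HPeriodic N (average S ω v) := by
  intro z
  simp only [average_apply]
  congr 1
  ext y
  rw [← hv.bilinear_add_natCast (((z.1 : ℝ), (z.2 : ℝ)) + y)]
  congr 1
  ext <;> simp [add_right_comm]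

end HPeriodic

/-- The image `v'` arises from `v` by filling the row `m` in such a way that the values in that row
are the averages over the stencil. -/
def FillsRow (S : Finset (ℝ × ℝ)) (ω : ℝ × ℝ → ℝ) (m : ℤ) (v v' : ℤ × ℤ → ℝ) : Prop :=
  (∀ z : ℤ × ℤ, z.2 ≠ m → v' z = v z) ∧ ∀ z : ℤ × ℤ, z.2 = m → v' z = average S ω v' z

/-- The image `v` with the row `m` replaced by the `N`-periodic row `f`. -/
def replaceRow {N : ℕ} (m : ℤ) (v : ℤ × ℤ → ℝ) (f : ZMod N → ℝ) (z : ℤ × ℤ) : ℝ :=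
  if z.2 = m then f z.1 else v z

theorem HPeriodic.replaceRow {N : ℕ} {v : ℤ × ℤ → ℝ} (hv : HPeriodic N v) (m : ℤ)
    (f : ZMod N → ℝ) : HPeriodic N (replaceRow m v f) := by
  intro z
  simp only [Inpainting.replaceRow, Int.cast_add, Int.cast_natCast, ZMod.natCast_self, add_zero,
    hv z]

namespace Admissible

variable {r : ℝ} {S : Finset (ℝ × ℝ)} {ω : ℝ × ℝ → ℝ} {N : ℕ} [NeZero N]

theorem fillsRow_le (hS : Admissible r S ω) {m : ℤ} {v v₁ v₂ : ℤ × ℤ → ℝ}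
    (h₁ : FillsRow S ω m v v₁) (h₂ : FillsRow S ω m v v₂) (p₁ : HPeriodic N v₁)
    (p₂ : HPeriodic N v₂) : v₂ ≤ v₁ := by
  intro z
  by_cases hz : z.2 = m
  · obtain ⟨C, hC⟩ := (p₁.sub p₂).exists_abs_le m m
    refine sub_nonneg.1 (hS.nonneg_of_average_le_of_row (F := v₁ - v₂) (m := m)
      (fun ζ _ h ↦ ?_) ⟨C, fun ζ hζ ↦ (abs_le.1 (hC ζ hζ.ge hζ.le)).1⟩ (fun ζ hζ ↦ ?_) z hz)
    · rw [Pi.sub_apply, h₁.1 ζ h.ne, h₂.1 ζ h.ne, sub_self]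
    · rw [map_sub, Pi.sub_apply, Pi.sub_apply, ← h₁.2 ζ hζ, ← h₂.2 ζ hζ]
  · rw [h₁.1 z hz, h₂.1 z hz]

theorem fillsRow_unique (hS : Admissible r S ω) {m : ℤ} {v v₁ v₂ : ℤ × ℤ → ℝ}
    (h₁ : FillsRow S ω m v v₁) (h₂ : FillsRow S ω m v v₂) (p₁ : HPeriodic N v₁)
    (p₂ : HPeriodic N v₂) : v₁ = v₂ :=
  le_antisymm (hS.fillsRow_le h₂ h₁ p₂ p₁) (hS.fillsRow_le h₁ h₂ p₁ p₂)

theorem average_replaceRow_sub_le (hS : Admissible r S ω) (v : ℤ × ℤ → ℝ) (f f' : ZMod N → ℝ)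
    (z : ℤ × ℤ) :
    average S ω (replaceRow z.2 v f') z - average S ω (replaceRow z.2 v f) z ≤
      contractionFactor r S ω * dist f f' := by
  have lower := hS.neg_contractionFactor_mul_le_average (z := z)
    (F := replaceRow z.2 v f - replaceRow z.2 v f') dist_nonneg
    (fun ζ _ h ↦ by simp only [Pi.sub_apply, replaceRow, if_neg h.ne, sub_self, le_refl])
    (fun ζ h ↦ by
      simp only [Pi.sub_apply, replaceRow, if_pos h]
      exact (abs_le.1 (dist_le_pi_dist f f' ζ.1)).1)
  rw [map_sub, Pi.sub_apply] at lower
  linarith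

theorem contractingWith_average_replaceRow (hS : Admissible r S ω) (m : ℤ) (v : ℤ × ℤ → ℝ) :
    ContractingWith (contractionFactor r S ω).toNNReal
      fun (f : ZMod N → ℝ) i ↦ average S ω (replaceRow m v f) (i.val, m) := by
  have hq := hS.contractionFactor_nonneg
  refine ⟨Real.toNNReal_lt_one.2 hS.contractionFactor_lt_one,
    LipschitzWith.of_dist_le_mul fun f f' ↦ ?_⟩
  rw [Real.coe_toNNReal _ hq, dist_pi_le_iff (mul_nonneg hq dist_nonneg)]
  intro i
  have upper := hS.average_replaceRow_sub_le v f f' (i.val, m)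
  have lower := hS.average_replaceRow_sub_le v f' f (i.val, m)
  rw [dist_comm f' f] at lower
  exact abs_le.2 ⟨by linarith, lower⟩

theorem exists_fillsRow (hS : Admissible r S ω) (m : ℤ) {v : ℤ × ℤ → ℝ} (hv : HPeriodic N v) :
    ∃ v', FillsRow S ω m v v' ∧ HPeriodic N v' := by
  have contracting := hS.contractingWith_average_replaceRow (N := N) m v
  set f := contracting.fixedPoint
  refine ⟨replaceRow m v f, ⟨fun z hz ↦ if_neg hz, fun z hz ↦ ?_⟩, hv.replaceRow m f⟩
  rw [((hv.replaceRow m f).average S ω).eq_val z, hz]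
  exact (if_pos hz).trans (congrFun contracting.fixedPoint_isFixedPt (z.1 : ZMod N)).symm

end Admissible

theorem readable_eq {N k : ℕ} (hk : k ≤ N) : readable N k = {p : ℝ × ℝ | p.2 ≤ k} := by
  ext p
  simp only [readable, unfilledRegion, unfilledPixels, Set.mem_sdiff, mem_ofPred_eq, not_and,
    not_exists]
  refine ⟨fun ⟨h1, h2⟩ ↦ ?_, fun h ↦ ⟨h.trans (by exact_mod_cast hk), fun _ z hz _ hlt ↦ ?_⟩⟩
  · by_contra! hlt
    refine h2 h1 (⌊p.1⌋, ⌈p.2⌉) ⟨Int.lt_ceil.2 (by exact_mod_cast hlt), Int.ceil_le.2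
      (by exact_mod_cast h1)⟩ (abs_floor_sub_lt_one p.1) (abs_lt.2 ⟨?_, ?_⟩)
    · linarith [Int.le_ceil p.2]
    · linarith [Int.ceil_lt_add_one p.2]
  · have : (k : ℝ) + 1 ≤ z.2 := by exact_mod_cast hz.1
    linarith [(abs_lt.1 hlt).2]

theorem mem_of_mem_stencil {method : Method} {A : Finset (ℝ × ℝ)} {y : ℝ × ℝ}
    (hy : y ∈ stencil method A) : y ∈ A := by
  classical
  cases method <;> exact (Finset.mem_filter.1 hy).1

theorem snd_nonpos_of_mem_stencil {method : Method} {A : Finset (ℝ × ℝ)} {y : ℝ × ℝ}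
    (hy : y ∈ stencil method A) : y.2 ≤ 0 := by
  classical
  cases method
  · linarith [(Finset.mem_filter.1 hy).2.2]
  · exact (Finset.mem_filter.1 hy).2.2

section Update

variable {N k : ℕ} (r : ℝ) (A : Finset (ℝ × ℝ)) (w : ℝ × ℝ → ℝ) (v : ℤ × ℤ → ℝ) {z : ℤ × ℤ}

open Classical in
theorem update_eq_average {method : Method} {R : Set (ℝ × ℝ)}
    (h : {y ∈ A | y ≠ 0 ∧ ((z.1 : ℝ), (z.2 : ℝ)) + y ∈ R} = stencil method A) :
    update r A w R v z = average (stencil method A) (fun y ↦ w (r⁻¹ • y)) v z := by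
  simp only [update, average_apply, Finset.centerMass, h, smul_eq_mul, div_eq_inv_mul]

theorem update_direct (hk : k ≤ N) (hz : z.2 = k + 1) :
    update r A w (readable N k) v z =
      average (stencil .direct A) (fun y ↦ w (r⁻¹ • y)) v z := by
  classical
  refine update_eq_average r A w v (Finset.filter_congr fun y _ ↦ and_congr_right fun _ ↦ ?_)
  rw [readable_eq hk, hz]
  simp only [mem_ofPred_eq, Prod.snd_add, Int.cast_add, Int.cast_natCast, Int.cast_one]
  exact ⟨fun h ↦ by linarith, fun h ↦ by linarith⟩

theorem update_semiImplicit (hk : k ≤ N) (hz : z.2 = k) :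
    update r A w (readable N k) v z =
      average (stencil .semiImplicit A) (fun y ↦ w (r⁻¹ • y)) v z := by
  classical
  refine update_eq_average r A w v (Finset.filter_congr fun y _ ↦ and_congr_right fun _ ↦ ?_)
  rw [readable_eq hk, hz]
  simp only [mem_ofPred_eq, Prod.snd_add, Int.cast_natCast]
  exact ⟨fun h ↦ by linarith, fun h ↦ by linarith⟩

end Update

theorem average_direct_congr {A : Finset (ℝ × ℝ)} {ω : ℝ × ℝ → ℝ} {v v' : ℤ × ℤ → ℝ} {z : ℤ × ℤ}
    (h : ∀ ζ : ℤ × ℤ, ζ.2 ≠ z.2 → v ζ = v' ζ) :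
    average (stencil .direct A) ω v z = average (stencil .direct A) ω v' z := by
  classical
  simp only [average_apply, Finset.centerMass]
  congr 1
  refine Finset.sum_congr rfl fun y hy ↦ ?_
  congr 1
  have hy2 : y.2 ≤ -1 := (Finset.mem_filter.1 hy).2.2
  have off_row (ζ : ℤ × ℤ) (h2 : |(ζ.2 : ℝ) - (((z.1 : ℝ), (z.2 : ℝ)) + y).2| < 1) :
      v ζ = v' ζ := by
    refine h ζ fun h3 ↦ ?_
    simp only [Prod.snd_add, h3] at h2
    linarith [(abs_lt.1 h2).2]
  exact le_antisymm (bilinear_mono fun ζ _ h2 ↦ (off_row ζ h2).le)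
    (bilinear_mono fun ζ _ h2 ↦ (off_row ζ h2).ge)

theorem step_iff_fillsRow (method : Method) {N k : ℕ} (hk : k < N) (r : ℝ) (A : Finset (ℝ × ℝ))
    (w : ℝ × ℝ → ℝ) (v v' : ℤ × ℤ → ℝ) :
    Step method N r A w k v v' ↔
      FillsRow (stencil method A) (fun y ↦ w (r⁻¹ • y)) (k + 1) v v' := by
  refine and_congr_right fun hrow ↦ forall_congr' fun z ↦ forall_congr' fun hz ↦ ?_
  cases method
  · simp only
    rw [update_direct r A w v hk.le hz, average_direct_congr fun ζ hζ ↦ (hrow ζ (hz ▸ hζ)).symm]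
  · simp only
    rw [update_semiImplicit (k := k + 1) r A w v' hk (by rw [hz]; push_cast; rfl)]

theorem admissible_stencil (method : Method) {r : ℝ} (hr : 1 ≤ r) {A : Finset (ℝ × ℝ)}
    (hA : ∀ y ∈ A, y.1 ^ 2 + y.2 ^ 2 ≤ r ^ 2) {w : ℝ × ℝ → ℝ} (hw : ∀ y, 0 ≤ w y)
    (hmass : 0 < totalMass method r A w) (hg : (centerOfMass method r A w).2 ≠ 0) :
    Admissible r (stencil method A) fun y ↦ w (r⁻¹ • y) where
  one_le := hr
  nonneg y _ := hw _
  mass_pos := hmass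
  abs_fst_le y hy := abs_le_of_sq_le_sq
    (by linarith [hA y (mem_of_mem_stencil hy), sq_nonneg y.2]) (by linarith)
  neg_le_snd y hy := (abs_le_of_sq_le_sq' (a := y.2) (b := r)
    (by linarith [hA y (mem_of_mem_stencil hy), sq_nonneg y.1]) (by linarith)).1
  snd_nonpos _ := snd_nonpos_of_mem_stencil
  drift := lt_of_le_of_ne ((convex_halfSpace_le (LinearMap.snd ℝ ℝ ℝ).isLinear 0).centerMass_mem
    (fun _ _ ↦ hw _) hmass fun _ ↦ snd_nonpos_of_mem_stencil) hg

theorem damagedImage_hperiodic {N : ℕ} [NeZero N] {u₀ : ℝ × ℝ → ℝ}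
    (hper : ∀ a b : ℝ, u₀ (a + 1, b) = u₀ (a, b)) : HPeriodic N (damagedImage N u₀) := by
  intro z
  have hN : (N : ℝ) ≠ 0 := NeZero.ne _
  simp only [damagedImage, Int.cast_add, Int.cast_natCast, add_div, div_self hN, hper]

section IsInpainted

variable {method : Method} {N : ℕ} {r : ℝ} {A : Finset (ℝ × ℝ)} {w u₀ : ℝ × ℝ → ℝ}

theorem existsUnique_isInpainted [NeZero N]
    (hS : Admissible r (stencil method A) fun y ↦ w (r⁻¹ • y))
    (hper : ∀ a b : ℝ, u₀ (a + 1, b) = u₀ (a, b)) :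
    ∃! u : ℤ × ℤ → ℝ, IsInpainted method N r A w u₀ u := by
  have fill (k : ℕ) (v : {v // HPeriodic N v}) : ∃ v' : {v // HPeriodic N v},
      FillsRow (stencil method A) (fun y ↦ w (r⁻¹ • y)) (k + 1) v.1 v'.1 := by
    obtain ⟨v', hfill, hv'⟩ := hS.exists_fillsRow (k + 1) v.2
    exact ⟨⟨v', hv'⟩, hfill⟩
  choose next hnext using fill
  let V : ℕ → {v // HPeriodic N v} :=
    Nat.rec ⟨damagedImage N u₀, damagedImage_hperiodic hper⟩ next
  refine ⟨(V N).1, ⟨fun k ↦ (V k).1, rfl, fun k _ ↦ (V k).2,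
    fun k hk ↦ (step_iff_fillsRow method hk r A w _ _).2 (hnext k (V k)), rfl⟩, ?_⟩
  rintro u ⟨v, hv0, hvper, hvstep, rfl⟩
  have rows_eq (k : ℕ) (hk : k ≤ N) : v k = (V k).1 := by
    induction k with
    | zero => exact hv0
    | succ k ih =>
      have hfill := (step_iff_fillsRow method hk r A w _ _).1 (hvstep k hk)
      rw [ih (by omega)] at hfill
      exact hS.fillsRow_unique hfill (hnext k (V k)) (hvper (k + 1) hk) (V (k + 1)).2
  exact rows_eq N le_rfl

namespace IsInpainted

variable {u : ℤ × ℤ → ℝ}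

theorem hperiodic (hu : IsInpainted method N r A w u₀ u) : HPeriodic N u := by
  obtain ⟨v, -, hvper, -, rfl⟩ := hu
  exact hvper N le_rfl

theorem exists_fillsRow (hu : IsInpainted method N r A w u₀ u) :
    ∃ v : ℕ → ℤ × ℤ → ℝ, v 0 = damagedImage N u₀ ∧
      (∀ k < N, FillsRow (stencil method A) (fun y ↦ w (r⁻¹ • y)) (k + 1) (v k) (v (k + 1))) ∧
      ∀ k ≤ N, ∀ z : ℤ × ℤ, z.2 ≤ k → u z = v k z := by
  obtain ⟨v, hv0, -, hvstep, rfl⟩ := hu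
  have hfill (k : ℕ) (hk : k < N) := (step_iff_fillsRow method hk r A w _ _).1 (hvstep k hk)
  refine ⟨v, hv0, hfill, fun k hkN ↦ ?_⟩
  suffices stable : ∀ n ≥ k, n ≤ N → ∀ z : ℤ × ℤ, z.2 ≤ k → v n z = v k z from
    stable N hkN le_rfl
  intro n hkn
  induction n, hkn using Nat.le_induction with
  | base => exact fun _ _ _ ↦ rfl
  | succ n hkn ih =>
    intro hn z hz
    rw [(hfill n (by omega)).1 z (by omega), ih (by omega) z hz]

theorem eq_data (hu : IsInpainted method N r A w u₀ u) {z : ℤ × ℤ} (hz : z.2 ≤ 0) :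
    u z = u₀ ((z.1 : ℝ) / N, (z.2 : ℝ) / N) := by
  obtain ⟨v, hv0, -, hv⟩ := hu.exists_fillsRow
  rw [hv 0 N.zero_le z hz, hv0, damagedImage, if_pos hz]

theorem average_eq (hu : IsInpainted method N r A w u₀ u)
    (hS : Admissible r (stencil method A) fun y ↦ w (r⁻¹ • y)) {z : ℤ × ℤ} (h1 : 1 ≤ z.2)
    (h2 : z.2 ≤ N) : average (stencil method A) (fun y ↦ w (r⁻¹ • y)) u z = u z := by
  obtain ⟨v, -, hfill, hv⟩ := hu.exists_fillsRow
  obtain ⟨k, hk⟩ : ∃ k : ℕ, z.2 = k + 1 := ⟨(z.2 - 1).toNat, by omega⟩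
  have hkN : k < N := by omega
  rw [hv (k + 1) hkN z (by push_cast; omega), (hfill k hkN).2 z hk]
  exact hS.average_congr fun ζ hζ ↦ hv (k + 1) hkN ζ (by push_cast; omega)

end IsInpainted

end IsInpainted

/-! ### Taylor expansion in Hölder classes -/

/-- The linear term of the Taylor expansion at `p` of a function in `W^{s,∞}(S)`, as far as it is of
order less than `min s 2`: the derivative if `1 < s`, and zero otherwise. -/
noncomputable def taylorGrad (s : ℝ) (S : Set (ℝ × ℝ)) (u : ℝ × ℝ → ℝ) (p : ℝ × ℝ) :
    (ℝ × ℝ) →L[ℝ] ℝ :=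
  open Classical in if 1 < s then fderivWithin ℝ u S p else 0

section Taylor

variable {S : Set (ℝ × ℝ)} {u : ℝ × ℝ → ℝ} {p q : ℝ × ℝ}

theorem norm_fderivWithin_le (hS : UniqueDiffOn ℝ S) (hp : p ∈ S) :
    ‖fderivWithin ℝ u S p‖ ≤ ‖iteratedFDerivWithin ℝ 1 u S p‖ := by
  refine ContinuousLinearMap.opNorm_le_bound _ (norm_nonneg _) fun v ↦ ?_
  simpa [iteratedFDerivWithin_one_apply (hS p hp)] using
    (iteratedFDerivWithin ℝ 1 u S p).le_opNorm fun _ ↦ v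

theorem norm_fderivWithin_sub_le (hS : UniqueDiffOn ℝ S) (hp : p ∈ S) (hq : q ∈ S) :
    ‖fderivWithin ℝ u S p - fderivWithin ℝ u S q‖ ≤
      ‖iteratedFDerivWithin ℝ 1 u S p - iteratedFDerivWithin ℝ 1 u S q‖ := by
  refine ContinuousLinearMap.opNorm_le_bound _ (norm_nonneg _) fun v ↦ ?_
  simpa [iteratedFDerivWithin_one_apply (hS p hp), iteratedFDerivWithin_one_apply (hS q hq)] using
    (iteratedFDerivWithin ℝ 1 u S p - iteratedFDerivWithin ℝ 1 u S q).le_opNorm fun _ ↦ v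

theorem abs_sub_sub_fderivWithin_le (hS : Convex ℝ S) (hu : DifferentiableOn ℝ u S) {C β : ℝ}
    (hC : 0 ≤ C) (hβ : 0 ≤ β)
    (hH : ∀ p ∈ S, ∀ q ∈ S, ‖fderivWithin ℝ u S p - fderivWithin ℝ u S q‖ ≤ C * ‖p - q‖ ^ β)
    (hp : p ∈ S) (hq : q ∈ S) :
    |u q - u p - fderivWithin ℝ u S p (q - p)| ≤ C * ‖q - p‖ ^ (1 + β) := by
  have hseg : segment ℝ p q ⊆ S := hS.segment_subset hp hq
  have mean_value := (convex_segment p q).norm_image_sub_le_of_norm_hasFDerivWithin_le'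
    (f := u) (f' := fderivWithin ℝ u S) (φ := fderivWithin ℝ u S p) (C := C * ‖q - p‖ ^ β)
    (fun x hx ↦ (hu x (hseg hx)).hasFDerivWithinAt.mono hseg)
    (fun x hx ↦ (hH x (hseg hx) p hp).trans (by
      gcongr
      obtain ⟨t, ht, rfl⟩ := segment_eq_image' ℝ p q ▸ hx
      simp only [add_sub_cancel_left, norm_smul, Real.norm_eq_abs, abs_of_nonneg ht.1]
      exact mul_le_of_le_one_left (norm_nonneg _) ht.2))
    (left_mem_segment ℝ p q) (right_mem_segment ℝ p q)
  rwa [Real.norm_eq_abs, mul_assoc, mul_comm (_ ^ β),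
    ← Real.rpow_one_add' (norm_nonneg _) (by linarith)] at mean_value

namespace MemSobolevInf

variable {s : ℝ}

theorem differentiableOn (h : MemSobolevInf s S u) (hs : 1 < s) : DifferentiableOn ℝ u S := by
  obtain ⟨k, α, hk, -, hα1, hcd, -⟩ := h.2 (by linarith)
  refine hcd.differentiableOn ?_
  rintro hk0
  have : k = 0 := by exact_mod_cast hk0
  subst this
  push_cast at hk
  linarith

theorem exists_abs_sub_le (h : MemSobolevInf s S u) (hs : 0 ≤ s) (hs1 : s ≤ 1) :
    ∃ C, 0 ≤ C ∧ ∀ p ∈ S, ∀ q ∈ S, |u q - u p| ≤ C * ‖q - p‖ ^ s := by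
  rcases hs.eq_or_lt with rfl | hs0
  · obtain ⟨C, hC⟩ := h.1
    refine ⟨2 * |C|, by positivity, fun p hp q hq ↦ (abs_sub _ _).trans ?_⟩
    rw [Real.rpow_zero]
    linarith [hC p hp, hC q hq, le_abs_self C]
  · obtain ⟨k, α, hk, hα0, -, -, C, -, hC⟩ := h.2 hs0
    obtain rfl : k = 0 := by
      have : (k : ℝ) < 1 := by linarith
      exact Nat.lt_one_iff.1 (by exact_mod_cast this)
    obtain rfl : s = α := by simpa using hk
    refine ⟨|C|, abs_nonneg _, fun p hp q hq ↦ ?_⟩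
    have eval := (iteratedFDerivWithin ℝ 0 u S q - iteratedFDerivWithin ℝ 0 u S p).le_opNorm 0
    simp only [sub_apply, iteratedFDerivWithin_zero_apply, Finset.univ_eq_empty,
      Finset.prod_empty, mul_one, Real.norm_eq_abs] at eval
    refine eval.trans ((hC q hq p hp).trans ?_)
    gcongr
    exact le_abs_self C

theorem exists_norm_fderivWithin_le (h : MemSobolevInf s S u) (hs : 1 < s) (hS : Convex ℝ S)
    (hi : (interior S).Nonempty) :
    ∃ C, 0 ≤ C ∧ (∀ p ∈ S, ‖fderivWithin ℝ u S p‖ ≤ C) ∧ ∀ p ∈ S, ∀ q ∈ S,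
      ‖fderivWithin ℝ u S p - fderivWithin ℝ u S q‖ ≤ C * ‖p - q‖ ^ (min s 2 - 1) := by
  have hU : UniqueDiffOn ℝ S := uniqueDiffOn_convex hS hi
  obtain ⟨k, α, hk, hα0, hα1, hcd, C, hbound, hholder⟩ := h.2 (by linarith)
  have hk1 : 1 ≤ k := by
    have : (0 : ℝ) < k := by linarith
    exact_mod_cast this
  refine ⟨|C|, abs_nonneg _, fun p hp ↦
    (norm_fderivWithin_le hU hp).trans ((hbound 1 hk1 p hp).trans (le_abs_self C)),
    fun p hp q hq ↦ (norm_fderivWithin_sub_le hU hp hq).trans ?_⟩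
  rcases hk1.eq_or_lt with rfl | hk2
  · rw [min_eq_left (by rw [hk]; push_cast; linarith), hk, Nat.cast_one, add_sub_cancel_left]
    refine (hholder p hp q hq).trans ?_
    gcongr
    exact le_abs_self C
  · have : (2 : ℝ) ≤ k := by exact_mod_cast hk2
    rw [min_eq_right (by linarith), show (2 : ℝ) - 1 = 1 by norm_num, Real.rpow_one]
    refine hS.norm_image_sub_le_of_norm_fderivWithin_le (f := iteratedFDerivWithin ℝ 1 u S)
      (hcd.differentiableOn_iteratedFDerivWithin (by exact_mod_cast hk2) hU) (fun x hx ↦ ?_) hq hp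
    rw [norm_fderivWithin_iteratedFDerivWithin]
    exact (hbound 2 hk2 x hx).trans (le_abs_self C)

theorem exists_taylor_le (h : MemSobolevInf s S u) (hs : 0 ≤ s) (hS : Convex ℝ S)
    (hi : (interior S).Nonempty) :
    ∃ C, 0 ≤ C ∧ ∀ p ∈ S, ‖taylorGrad s S u p‖ ≤ C ∧
      ∀ q ∈ S, |u q - u p - taylorGrad s S u p (q - p)| ≤ C * ‖q - p‖ ^ min s 2 := by
  rcases le_or_gt s 1 with hs1 | hs1
  · obtain ⟨C, hC, hholder⟩ := h.exists_abs_sub_le hs hs1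
    refine ⟨C, hC, fun p hp ↦ ?_⟩
    simp only [taylorGrad, if_neg hs1.not_gt, norm_zero, zero_apply, sub_zero,
      min_eq_left (hs1.trans one_le_two)]
    exact ⟨hC, fun q hq ↦ hholder p hp q hq⟩
  · obtain ⟨C, hC, hbound, hholder⟩ := h.exists_norm_fderivWithin_le hs1 hS hi
    refine ⟨C, hC, fun p hp ↦ ?_⟩
    simp only [taylorGrad, if_pos hs1]
    refine ⟨hbound p hp, fun q hq ↦ ?_⟩
    simpa only [add_sub_cancel] using abs_sub_sub_fderivWithin_le hS (h.differentiableOn hs1) hC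
      (sub_nonneg.2 (le_min hs1.le one_le_two)) hholder hp hq

end MemSobolevInf

end Taylor

/-! ### The regions between the triangles -/

section Regions

variable {M : ℕ} {δ L : ℝ} {x : Fin M → ℝ}

/-- The distance on the circle `ℝ / ℤ` from `a` to the closest tip. -/
noncomputable def tipDist (x : Fin M → ℝ) (a : ℝ) : ℝ :=
  Metric.infDist (a : UnitAddCircle) (range fun i ↦ (x i : UnitAddCircle))

theorem tipDist_nonneg (x : Fin M → ℝ) (a : ℝ) : 0 ≤ tipDist x a := Metric.infDist_nonneg

theorem tipDist_sub_intCast (x : Fin M → ℝ) (a : ℝ) (n : ℤ) : tipDist x (a - n) = tipDist x a := by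
  have : ((n : ℝ) : UnitAddCircle) = 0 := (AddCircle.coe_eq_zero_iff _).2 ⟨n, by simp⟩
  rw [tipDist, AddCircle.coe_sub, this, sub_zero, tipDist]

theorem tipDist_le_abs_sub {a b : ℝ} {i : Fin M} (hb : (b : UnitAddCircle) = x i) :
    tipDist x a ≤ |a - b| := by
  refine (Metric.infDist_le_dist_of_mem (mem_range_self i)).trans ?_
  rw [← hb, dist_eq_norm, ← AddCircle.coe_sub, UnitAddCircle.norm_eq]
  simpa using round_le (a - b) 0

theorem tipDist_self (x : Fin M → ℝ) (i : Fin M) : tipDist x (x i) = 0 :=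
  Metric.infDist_zero_of_mem (mem_range_self i)

theorem convex_undamaged (δ : ℝ) : Convex ℝ (undamaged δ) :=
  (convex_Ioc (-δ) 0).linear_preimage (LinearMap.snd ℝ ℝ ℝ)

theorem nonempty_interior_undamaged (hδ : 0 < δ) : (interior (undamaged δ)).Nonempty := by
  refine ⟨(0, -δ / 2), mem_interior.2 ⟨Prod.snd ⁻¹' Ioo (-δ) 0, fun p hp ↦ ⟨hp.1, hp.2.le⟩,
    isOpen_Ioo.preimage continuous_snd, ?_, ?_⟩⟩ <;> dsimp only <;> linarith

variable [NeZero M]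

theorem mem_between_iff (hL : 0 < L) {i : Fin M} {p : ℝ × ℝ} :
    p ∈ between δ L x i ↔
      p ∈ undamaged δ ∧ leftTip x i < p.1 + p.2 / L ∧ p.1 - p.2 / L < x i := by
  have mem_triangle {a} (hp : p ∈ undamaged δ) :
      p ∈ triangle δ L a ↔ |a - p.1| ≤ -(p.2 / L) := by
    rw [← neg_div, le_div_iff₀' hL]
    exact ⟨fun h ↦ by linarith [h.2.2], fun h ↦ ⟨hp.1.le, hp.2, by linarith⟩⟩
  simp only [between, Set.mem_sdiff, mem_union, Set.mem_ofPred_eq, not_or, and_assoc,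
    and_congr_right_iff]
  intro hp
  have : p.2 / L ≤ 0 := div_nonpos_of_nonpos_of_nonneg hp.2 hL.le
  rw [mem_triangle hp, mem_triangle hp]
  constructor
  · rintro ⟨h₁, h₂, h₃, h₄⟩
    rw [abs_of_neg (by linarith)] at h₃
    rw [abs_of_pos (by linarith)] at h₄
    constructor <;> linarith
  · rintro ⟨h₁, h₂⟩
    rw [abs_of_neg (by linarith), abs_of_pos (by linarith)]
    refine ⟨?_, ?_, ?_, ?_⟩ <;> linarith

theorem convex_between (hL : 0 < L) (i : Fin M) : Convex ℝ (between δ L x i) := by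
  have between_eq : between δ L x i =
      undamaged δ ∩ ({p | leftTip x i < p.1 + p.2 / L} ∩ {p | p.1 - p.2 / L < x i}) :=
    ext fun _ ↦ mem_between_iff hL
  rw [between_eq]
  refine (convex_undamaged δ).inter ((convex_halfSpace_gt ⟨fun p q ↦ ?_, fun c p ↦ ?_⟩ _).inter
    (convex_halfSpace_lt ⟨fun p q ↦ ?_, fun c p ↦ ?_⟩ _)) <;>
  simp only [Prod.fst_add, Prod.snd_add, Prod.smul_fst, Prod.smul_snd, smul_eq_mul] <;> ring

theorem sub_one_lt_of_ne_zero {i : Fin M} (h : i ≠ 0) : i - 1 < i := by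
  obtain ⟨n, rfl⟩ := Nat.exists_eq_succ_of_ne_zero (NeZero.ne M)
  exact Fin.sub_one_lt_iff.2 (Fin.pos_iff_ne_zero.2 h)

theorem leftTip_lt (hx : StrictMono x) (hx01 : ∀ i, x i ∈ Ioc (0 : ℝ) 1) (i : Fin M) :
    leftTip x i < x i := by
  unfold leftTip
  split_ifs with h
  · linarith [(hx01 (i - 1)).2, (hx01 i).1]
  · exact hx (sub_one_lt_of_ne_zero h)

theorem exists_coe_leftTip_eq (x : Fin M → ℝ) (i : Fin M) :
    ∃ j, (leftTip x i : UnitAddCircle) = x j := by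
  refine ⟨i - 1, ?_⟩
  unfold leftTip
  split_ifs
  · simp
  · rfl

theorem nonempty_interior_between (hδ : 0 < δ) (hL : 0 < L) {i : Fin M}
    (hi : leftTip x i < x i) : (interior (between δ L x i)).Nonempty := by
  set l := leftTip x i
  set d := (x i - l) / 2 with hd
  have hd0 : 0 < d := by linarith
  set m := min δ (L * d)
  have hm : 0 < m := lt_min hδ (by positivity)
  have hm₁ : m ≤ δ := min_le_left _ _
  have hm₂ : m / L ≤ d := (div_le_iff₀' hL).2 (min_le_right _ _)
  have : 0 < m / L := by positivity
  refine ⟨((l + x i) / 2, -(m / 2)), mem_interior.2 ⟨{p | (-δ < p.2 ∧ p.2 < 0) ∧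
    l < p.1 + p.2 / L ∧ p.1 - p.2 / L < x i},
    fun p hp ↦ (mem_between_iff hL).2 ⟨⟨hp.1.1, hp.1.2.le⟩, hp.2⟩, ?_, ?_⟩⟩
  · exact ((isOpen_lt (by fun_prop) (by fun_prop)).and (isOpen_lt (by fun_prop) (by fun_prop))).and
      ((isOpen_lt (by fun_prop) (by fun_prop)).and (isOpen_lt (by fun_prop) (by fun_prop)))
  · have half : -(m / 2) / L = -(m / L / 2) := by ring
    refine ⟨⟨?_, ?_⟩, ?_, ?_⟩ <;> dsimp only <;> linarith

theorem exists_eq_or_mem_Ioo_leftTip (hx01 : ∀ i, x i ∈ Ioc (0 : ℝ) 1) (a : ℝ) :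
    ∃ n : ℤ, (∃ i, a - n = x i) ∨ ∃ i, a - n ∈ Ioo (leftTip x i) (x i) := by
  have ceil₁ := Int.le_ceil a
  have ceil₂ := Int.ceil_lt_add_one a
  by_cases hex : ∃ i, a - (⌈a⌉ - 1 : ℤ) ≤ x i
  · obtain ⟨i, hi, hmin⟩ := WellFounded.has_min (wellFounded_lt (α := Fin M))
      {i | a - (⌈a⌉ - 1 : ℤ) ≤ x i} hex
    refine ⟨⌈a⌉ - 1, (show a - (⌈a⌉ - 1 : ℤ) ≤ x i from hi).eq_or_lt.imp (fun h ↦ ⟨i, h⟩)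
      fun h ↦ ⟨i, ?_, h⟩⟩
    unfold leftTip
    split_ifs with h0
    · push_cast
      linarith [(hx01 (i - 1)).2]
    · exact not_le.1 fun hle ↦ hmin (i - 1) hle (sub_one_lt_of_ne_zero h0)
  · push Not at hex
    refine ⟨⌈a⌉, Or.inr ⟨0, ?_, by linarith [(hx01 0).1]⟩⟩
    have last := hex (0 - 1)
    push_cast at last
    rw [leftTip, if_pos rfl]
    linarith

end Regions

/-! ### Deviation of the boundary data from affine functions -/

section BoundaryData

variable {δ Λ κ ε c a : ℝ} {q : ℝ × ℝ}

theorem exists_rpow_le_mul_exp {b t : ℝ} (hκ : 0 < κ) (hb : 0 ≤ b) (ht : 0 ≤ t) :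
    ∃ C, 0 ≤ C ∧ ∀ τ : ℝ, 0 ≤ τ → (τ + b) ^ t ≤ C * Real.exp (κ * τ) := by
  set n := ⌈t⌉₊
  refine ⟨n.factorial / κ ^ n * Real.exp (κ * (1 + b)), by positivity, fun τ hτ ↦ ?_⟩
  have exp_series := Real.pow_div_factorial_le_exp (κ * (1 + b + τ)) (by positivity) n
  rw [mul_pow, div_le_iff₀ (by positivity), mul_comm, ← le_div_iff₀ (by positivity)] at exp_series
  calc (τ + b) ^ t ≤ (1 + b + τ) ^ t := Real.rpow_le_rpow (by positivity) (by linarith) ht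
    _ ≤ (1 + b + τ) ^ (n : ℝ) := Real.rpow_le_rpow_of_exponent_le (by linarith) (Nat.le_ceil t)
    _ = (1 + b + τ) ^ n := Real.rpow_natCast _ _
    _ ≤ Real.exp (κ * (1 + b + τ)) * n.factorial / κ ^ n := exp_series
    _ = _ := by rw [mul_add κ, Real.exp_add]; ring

theorem rpow_le_mul_rpow {b t : ℝ} (hε : 0 < ε) (hεδ : ε ≤ δ) (hbt : b ≤ t) :
    ε ^ t ≤ δ ^ (t - b) * ε ^ b := by
  calc ε ^ t = ε ^ (t - b) * ε ^ b := by rw [← Real.rpow_add hε, sub_add_cancel]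
    _ ≤ δ ^ (t - b) * ε ^ b := by gcongr

theorem abs_fst_sub_add_le {μ : ℝ} (hμ : 0 ≤ μ) (hεδ : ε ≤ δ) (hc : |c| ≤ Λ)
    (hq : q ∈ undamaged ε) :
    |q.1 - a| + μ * |q.2| ≤ √ε * (|q.1 - c * q.2 - a| / √ε + (Λ + μ) * √δ) := by
  have hε : 0 < ε := by linarith [hq.1, hq.2]
  have hΛ : 0 ≤ Λ := (abs_nonneg c).trans hc
  have : 0 < √ε := Real.sqrt_pos.2 hε
  have hy : |q.2| ≤ √ε * √δ := by
    calc |q.2| ≤ ε := abs_le.2 ⟨hq.1.le, hq.2.trans hε.le⟩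
      _ = √ε * √ε := (Real.mul_self_sqrt hε.le).symm
      _ ≤ √ε * √δ := by gcongr
  calc |q.1 - a| + μ * |q.2|
      = |(q.1 - c * q.2 - a) + c * q.2| + μ * |q.2| := by ring_nf
    _ ≤ |q.1 - c * q.2 - a| + |c| * |q.2| + μ * |q.2| := by
        gcongr
        exact (abs_add_le _ _).trans_eq (by rw [abs_mul])
    _ ≤ |q.1 - c * q.2 - a| + Λ * (√ε * √δ) + μ * (√ε * √δ) := by gcongr
    _ = √ε * (|q.1 - c * q.2 - a| / √ε + (Λ + μ) * √δ) := by field_simp; ring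

theorem norm_sub_rpow_le {t : ℝ} (ht : 0 ≤ t) (hεδ : ε ≤ δ) (hc : |c| ≤ Λ)
    (hq : q ∈ undamaged ε) :
    ‖q - (a, 0)‖ ^ t ≤ ε ^ (t / 2) * (|q.1 - c * q.2 - a| / √ε + (Λ + 1) * √δ) ^ t := by
  have hε : 0 ≤ ε := by linarith [hq.1, hq.2]
  have hΛ : 0 ≤ Λ := (abs_nonneg c).trans hc
  have norm_le : ‖q - (a, 0)‖ ≤ |q.1 - a| + 1 * |q.2| := by
    rw [Prod.norm_def]
    refine max_le ?_ ?_ <;> simp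
  calc ‖q - (a, 0)‖ ^ t
      ≤ (√ε * (|q.1 - c * q.2 - a| / √ε + (Λ + 1) * √δ)) ^ t := by
        gcongr
        exact norm_le.trans (abs_fst_sub_add_le zero_le_one hεδ hc hq)
    _ = _ := by
        rw [Real.mul_rpow (Real.sqrt_nonneg ε) (by positivity), Real.sqrt_eq_rpow,
          ← Real.rpow_mul hε, one_div_mul_eq_div]

theorem abs_map_mul_self_le {B : ℝ} {G : (ℝ × ℝ) →L[ℝ] ℝ} (hG : ‖G‖ ≤ B) (hc : |c| ≤ Λ) (y : ℝ) :
    |G (c * y, y)| ≤ B * ((Λ + 1) * |y|) := by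
  refine (G.le_opNorm _).trans ?_
  have hΛ : 0 ≤ Λ := (abs_nonneg c).trans hc
  have norm_le : ‖(c * y, y)‖ ≤ (Λ + 1) * |y| := by
    rw [Prod.norm_def, Real.norm_eq_abs, Real.norm_eq_abs, abs_mul]
    exact max_le (by gcongr; linarith) (le_mul_of_one_le_left (abs_nonneg y) (by linarith))
  gcongr
  exact (norm_nonneg G).trans hG

variable {s s' : ℝ} {S T : Set (ℝ × ℝ)} {u : ℝ × ℝ → ℝ}

theorem MemSobolevInf.exists_abs_sub_le_exp (h : MemSobolevInf s S u) (hs : 0 ≤ s)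
    (hS : Convex ℝ S) (hi : (interior S).Nonempty) (hδ : 0 < δ) (hΛ : 0 ≤ Λ) (hκ : 0 < κ) :
    ∃ C, 0 ≤ C ∧ ∀ ε c a q, ε ≤ δ → |c| ≤ Λ → (a, 0) ∈ S → q ∈ S → q ∈ undamaged ε →
      |u q - u (a, 0) - taylorGrad s S u (a, 0) (1, 0) * (q.1 - c * q.2 - a)| ≤
        C * ε ^ (min s 2 / 2) * Real.exp (κ * (|q.1 - c * q.2 - a| / √ε)) := by
  set t := min s 2
  have ht : 0 ≤ t := le_min hs zero_le_two
  obtain ⟨B, hB, taylor⟩ := h.exists_taylor_le hs hS hi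
  obtain ⟨C, hC, rpow_le⟩ := exists_rpow_le_mul_exp (b := (Λ + 1) * √δ) hκ (by positivity) ht
  refine ⟨B * (C + (Λ + 1) * δ ^ (1 - t / 2)), by positivity, fun ε c a q hεδ hc ha hq hqε ↦ ?_⟩
  obtain ⟨hG, remainder⟩ := taylor _ ha
  set G := taylorGrad s S u (a, 0)
  set τ := |q.1 - c * q.2 - a| / √ε
  have hε : 0 < ε := by linarith [hqε.1, hqε.2]
  have hτ : 0 ≤ τ := by positivity
  have hy : |q.2| ≤ δ ^ (1 - t / 2) * ε ^ (t / 2) := by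
    calc |q.2| ≤ ε ^ (1 : ℝ) := by simpa using abs_le.2 ⟨hqε.1.le, hqε.2.trans hε.le⟩
      _ ≤ _ := rpow_le_mul_rpow hε hεδ (by linarith [min_le_right s 2])
  have split : q - (a, 0) = (q.1 - c * q.2 - a) • ((1 : ℝ), (0 : ℝ)) + (c * q.2, q.2) := by
    ext <;> simp
    ring
  calc |u q - u (a, 0) - G (1, 0) * (q.1 - c * q.2 - a)|
      = |(u q - u (a, 0) - G (q - (a, 0))) + G (c * q.2, q.2)| := by
        rw [split, map_add, map_smul, smul_eq_mul]
        ring_nf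
    _ ≤ B * ‖q - (a, 0)‖ ^ t + B * ((Λ + 1) * |q.2|) :=
        (abs_add_le _ _).trans (add_le_add (remainder q hq) (abs_map_mul_self_le hG hc q.2))
    _ ≤ B * (ε ^ (t / 2) * (C * Real.exp (κ * τ))) +
        B * ((Λ + 1) * (δ ^ (1 - t / 2) * ε ^ (t / 2))) * Real.exp (κ * τ) := by
        refine add_le_add (mul_le_mul_of_nonneg_left ?_ hB)
          (le_trans (by gcongr)
            (le_mul_of_one_le_right (by positivity) (Real.one_le_exp (by positivity))))
        refine (norm_sub_rpow_le ht hεδ hc hqε).trans ?_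
        gcongr
        exact rpow_le τ hτ
    _ = _ := by ring

theorem MemSobolevInf.taylorGrad_eq_of_subset (hT : MemSobolevInf s' T u) (hs' : 1 < s')
    (hss' : s' ≤ s) (hST : S ⊆ T) (hS : Convex ℝ S) (hi : (interior S).Nonempty) {p : ℝ × ℝ}
    (hp : p ∈ S) : taylorGrad s' T u p = taylorGrad s S u p := by
  rw [taylorGrad, taylorGrad, if_pos hs', if_pos (hs'.trans_le hss')]
  exact (fderivWithin_subset hST (uniqueDiffOn_convex hS hi p hp)
    (hT.differentiableOn hs' p (hST hp))).symm

theorem MemSobolevInf.exists_taylorGrad_sub_le (h : MemSobolevInf s S u)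
    (hT : MemSobolevInf s' T u) (hss' : s' ≤ s) (hST : S ⊆ T) (hS : Convex ℝ S)
    (hi : (interior S).Nonempty) (hδ : 0 < δ) (hκ : 0 < κ) :
    ∃ C, 0 ≤ C ∧ ∀ p ∈ S, ∀ ε t, 0 < ε → ε ≤ δ →
      |(taylorGrad s' T u p - taylorGrad s S u p) (1, 0) * t| ≤
        C * ε ^ (min s' 2 / 2) * Real.exp (κ * (|t| / √ε)) := by
  rcases lt_or_ge 1 s' with hs'1 | hs'1
  · exact ⟨0, le_rfl, fun p hp ε t _ _ ↦ by
      simp [hT.taylorGrad_eq_of_subset hs'1 hss' hST hS hi hp]⟩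
  rcases le_or_gt s 1 with hs1 | hs1
  · exact ⟨0, le_rfl, fun _ _ _ _ _ _ ↦ by simp [taylorGrad, hs1.not_gt, hs'1.not_gt]⟩
  obtain ⟨B, hB, norm_le, -⟩ := h.exists_norm_fderivWithin_le hs1 hS hi
  obtain ⟨C, hC, le_exp⟩ := exists_rpow_le_mul_exp (κ := κ) (b := 0) hκ le_rfl zero_le_one
  refine ⟨B * (δ ^ (1 / 2 - min s' 2 / 2) * C), by positivity, fun p hp ε t hε hεδ ↦ ?_⟩
  have grad_le : |fderivWithin ℝ u S p (1, 0)| ≤ B := by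
    simpa using ((fderivWithin ℝ u S p).le_opNorm (1, 0)).trans_eq' (by simp) |>.trans
      (mul_le_of_le_one_right (norm_nonneg _) (by simp [Prod.norm_def])) |>.trans (norm_le p hp)
  have sqrt_le : √ε ≤ δ ^ (1 / 2 - min s' 2 / 2) * ε ^ (min s' 2 / 2) := by
    rw [Real.sqrt_eq_rpow]
    exact rpow_le_mul_rpow hε hεδ (by linarith [min_le_left s' 2])
  have ht : |t| = √ε * (|t| / √ε) := (mul_div_cancel₀ _ (Real.sqrt_pos.2 hε).ne').symm
  have le_exp_t := le_exp (|t| / √ε) (by positivity)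
  rw [add_zero, Real.rpow_one] at le_exp_t
  rw [taylorGrad, taylorGrad, if_neg hs'1.not_gt, if_pos hs1, zero_sub, neg_apply, neg_mul,
    abs_neg, abs_mul]
  calc |fderivWithin ℝ u S p (1, 0)| * |t| ≤ B * (√ε * (|t| / √ε)) := by rw [← ht]; gcongr
    _ ≤ B * (δ ^ (1 / 2 - min s' 2 / 2) * ε ^ (min s' 2 / 2) *
        (C * Real.exp (κ * (|t| / √ε)))) := by gcongr
    _ = _ := by ring

theorem MemSobolevInf.exists_abs_sub_le_exp_of_subset (h : MemSobolevInf s S u)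
    (hT : MemSobolevInf s' T u) (hs' : 0 ≤ s') (hss' : s' ≤ s) (hST : S ⊆ T) (hS : Convex ℝ S)
    (hi : (interior S).Nonempty) (hTc : Convex ℝ T) (hδ : 0 < δ) (hΛ : 0 ≤ Λ) (hκ : 0 < κ) :
    ∃ C, 0 ≤ C ∧ ∀ ε c a q, ε ≤ δ → |c| ≤ Λ → (a, 0) ∈ S → q ∈ T → q ∈ undamaged ε →
      |u q - u (a, 0) - taylorGrad s S u (a, 0) (1, 0) * (q.1 - c * q.2 - a)| ≤
        C * ε ^ (min s' 2 / 2) * Real.exp (κ * (|q.1 - c * q.2 - a| / √ε)) := by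
  obtain ⟨C₁, hC₁, global⟩ :=
    hT.exists_abs_sub_le_exp hs' hTc (hi.mono (interior_mono hST)) hδ hΛ hκ
  obtain ⟨C₂, hC₂, slopes⟩ := h.exists_taylorGrad_sub_le hT hss' hST hS hi hδ hκ
  refine ⟨C₁ + C₂, by positivity, fun ε c a q hεδ hc ha hq hqε ↦ ?_⟩
  have hε : 0 < ε := by linarith [hqε.1, hqε.2]
  set ℓ := q.1 - c * q.2 - a
  set G := taylorGrad s S u (a, 0)
  set G' := taylorGrad s' T u (a, 0)
  calc |u q - u (a, 0) - G (1, 0) * ℓ|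
      = |(u q - u (a, 0) - G' (1, 0) * ℓ) + (G' - G) (1, 0) * ℓ| := by
        rw [sub_apply]; ring_nf
    _ ≤ C₁ * ε ^ (min s' 2 / 2) * Real.exp (κ * (|ℓ| / √ε)) +
        C₂ * ε ^ (min s' 2 / 2) * Real.exp (κ * (|ℓ| / √ε)) :=
      (abs_add_le _ _).trans (add_le_add (global ε c a q hεδ hc (hST ha) hq hqε)
        (slopes _ ha ε ℓ hε hεδ))
    _ = _ := by ring

end BoundaryData

section BoundaryLayers

variable {M : ℕ} {δ L Λ κ ε c a s s' : ℝ} {x : Fin M → ℝ} {u₀ : ℝ × ℝ → ℝ}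

/-- The profile of the boundary layers around the tips: they have width `√ε` and decay
exponentially. -/
noncomputable def layer (x : Fin M → ℝ) (κ ε a : ℝ) : ℝ :=
  Real.exp (-(κ * (tipDist x a / √ε)))

theorem layer_nonneg (x : Fin M → ℝ) (κ ε a : ℝ) : 0 ≤ layer x κ ε a := (Real.exp_pos _).le

theorem exp_le_exp_mul_layer {τ b : ℝ} (hκ : 0 ≤ κ) (hε : 0 < ε)
    (hτ : tipDist x a ≤ √ε * (τ + b)) :
    Real.exp (κ / 2 * τ) ≤ Real.exp (κ / 2 * b) * layer x (κ / 2) ε a * Real.exp (κ * τ) := by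
  rw [layer, ← Real.exp_add, ← Real.exp_add, Real.exp_le_exp]
  have := mul_le_mul_of_nonneg_left ((div_le_iff₀' (Real.sqrt_pos.2 hε)).2 hτ)
    (by positivity : 0 ≤ κ / 2)
  linarith

/-- The bound that the data satisfy near the bottom row: up to an affine function with slope `β`
across the lines of inverse slope `c`, they are small of the order expected for smooth data, except
in boundary layers around the tips, where only the global regularity counts. -/
def IsBoundaryBound (s s' κ : ℝ) (x : Fin M → ℝ) (u₀ : ℝ × ℝ → ℝ) (C ε c a β : ℝ) : Prop :=
  ∀ q ∈ undamaged ε, |u₀ q - u₀ (a, 0) - β * (q.1 - c * q.2 - a)| ≤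
    C * (ε ^ (min s 2 / 2) + ε ^ (min s' 2 / 2) * layer x (κ / 2) ε a) *
      Real.exp (κ * (|q.1 - c * q.2 - a| / √ε))

theorem IsBoundaryBound.mono {C C' β : ℝ} (h : IsBoundaryBound s s' κ x u₀ C ε c a β)
    (hC : C ≤ C') : IsBoundaryBound s s' κ x u₀ C' ε c a β := by
  intro q hq
  have hε : 0 < ε := by linarith [hq.1, hq.2]
  have := layer_nonneg x (κ / 2) ε a
  exact (h q hq).trans (by gcongr)

theorem map_sub_intCast (hper : ∀ a b : ℝ, u₀ (a + 1, b) = u₀ (a, b)) (a b : ℝ) (n : ℤ) :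
    u₀ (a - n, b) = u₀ (a, b) := by
  simpa using Function.Periodic.sub_int_mul_eq (f := fun t ↦ u₀ (t, b)) (hper · b) n (x := a)

theorem IsBoundaryBound.of_sub_intCast {C β : ℝ} {n : ℤ}
    (hper : ∀ a b : ℝ, u₀ (a + 1, b) = u₀ (a, b))
    (h : IsBoundaryBound s s' κ x u₀ C ε c (a - n) β) :
    IsBoundaryBound s s' κ x u₀ C ε c a β := by
  intro q hq
  have shifted := h (q.1 - n, q.2) hq
  rw [map_sub_intCast hper, map_sub_intCast hper,
    show layer x (κ / 2) ε (a - n) = layer x (κ / 2) ε a by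
      rw [layer, layer, tipDist_sub_intCast]] at shifted
  convert shifted using 4 <;> ring_nf

theorem exists_isBoundaryBound_tip (hδ : 0 < δ) (hs' : 0 ≤ s') (hΛ : 0 ≤ Λ) (hκ : 0 < κ)
    (hglobal : MemSobolevInf s' (undamaged δ) u₀) :
    ∃ C, ∀ ε c i, ε ≤ δ → |c| ≤ Λ → ∃ β, IsBoundaryBound s s' κ x u₀ C ε c (x i) β := by
  obtain ⟨C, hC, bound⟩ := hglobal.exists_abs_sub_le_exp hs' (convex_undamaged δ)
    (nonempty_interior_undamaged hδ) hδ hΛ hκ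
  refine ⟨C, fun ε c i hεδ hc ↦ ⟨_, fun q hqε ↦ (bound ε c (x i) q hεδ hc
    ⟨neg_lt_zero.2 hδ, le_rfl⟩ ⟨by linarith [hqε.1], hqε.2⟩ hqε).trans ?_⟩⟩
  have hε : 0 < ε := by linarith [hqε.1, hqε.2]
  have layer_eq_one : layer x (κ / 2) ε (x i) = 1 := by simp [layer, tipDist_self]
  rw [layer_eq_one, mul_one]
  gcongr
  exact le_add_of_nonneg_left (by positivity)

variable [NeZero M]

theorem tipDist_le_of_notMem_between {q : ℝ × ℝ} (hL : 0 < L) (hεδ : ε ≤ δ) (hc : |c| ≤ Λ)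
    {i : Fin M} (ha : a ∈ Ioo (leftTip x i) (x i)) (hqε : q ∈ undamaged ε)
    (hq : q ∉ between δ L x i) :
    tipDist x a ≤ √ε * (|q.1 - c * q.2 - a| / √ε + (Λ + 1 / L) * √δ) := by
  contrapose! hq with far
  obtain ⟨j, hj⟩ := exists_coe_leftTip_eq x i
  have close := (abs_fst_sub_add_le (a := a) (one_div_pos.2 hL).le hεδ hc hqε).trans_lt far
  have left := close.trans_le (tipDist_le_abs_sub hj)
  have right := close.trans_le (tipDist_le_abs_sub (rfl : (x i : UnitAddCircle) = x i))
  rw [abs_of_pos (sub_pos.2 ha.1), abs_of_nonpos hqε.2, one_div_mul_eq_div, neg_div] at left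
  rw [abs_of_neg (sub_neg.2 ha.2), abs_of_nonpos hqε.2, one_div_mul_eq_div, neg_div] at right
  have displacement := abs_le.1 (le_refl |q.1 - a|)
  exact (mem_between_iff hL).2
    ⟨⟨by linarith [hqε.1], hqε.2⟩, by linarith, by linarith⟩

theorem exists_isBoundaryBound_of_mem_Ioo (hδ : 0 < δ) (hL : 0 < L) (hs' : 0 ≤ s')
    (hss' : s' ≤ s) (hΛ : 0 ≤ Λ) (hκ : 0 < κ) {i : Fin M} (hi : leftTip x i < x i)
    (hglobal : MemSobolevInf s' (undamaged δ) u₀) (hlocal : MemSobolevInf s (between δ L x i) u₀) :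
    ∃ C, ∀ ε c a, ε ≤ δ → |c| ≤ Λ → a ∈ Ioo (leftTip x i) (x i) →
      ∃ β, IsBoundaryBound s s' κ x u₀ C ε c a β := by
  have hconv := convex_between (δ := δ) (x := x) hL i
  have hne := nonempty_interior_between hδ hL hi
  obtain ⟨C₁, hC₁, near⟩ :=
    hlocal.exists_abs_sub_le_exp (hs'.trans hss') hconv hne hδ hΛ hκ
  obtain ⟨C₂, hC₂, far⟩ := hlocal.exists_abs_sub_le_exp_of_subset hglobal hs' hss'
    (fun p hp ↦ ((mem_between_iff hL).1 hp).1) hconv hne (convex_undamaged δ) hδ hΛ (half_pos hκ)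
  set b := (Λ + 1 / L) * √δ
  refine ⟨C₁ + C₂ * Real.exp (κ / 2 * b), fun ε c a hεδ hc ha ↦
    ⟨taylorGrad s (between δ L x i) u₀ (a, 0) (1, 0), fun q hqε ↦ ?_⟩⟩
  have hε : 0 < ε := by linarith [hqε.1, hqε.2]
  have haS : (a, 0) ∈ between δ L x i :=
    (mem_between_iff hL).2 ⟨⟨neg_lt_zero.2 hδ, le_rfl⟩, by simpa using ha⟩
  have rough_nonneg : 0 ≤ ε ^ (min s' 2 / 2) * layer x (κ / 2) ε a :=
    mul_nonneg (by positivity) (layer_nonneg ..)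
  by_cases hq : q ∈ between δ L x i
  · refine (near ε c a q hεδ hc haS hq hqε).trans ?_
    gcongr
    · exact le_add_of_nonneg_right (by positivity)
    · exact le_add_of_nonneg_right rough_nonneg
  set ℓ := q.1 - c * q.2 - a
  have decay := exp_le_exp_mul_layer hκ.le hε (tipDist_le_of_notMem_between hL hεδ hc ha hqε hq)
  refine (far ε c a q hεδ hc haS ⟨by linarith [hqε.1], hqε.2⟩ hqε).trans ?_
  calc C₂ * ε ^ (min s' 2 / 2) * Real.exp (κ / 2 * (|ℓ| / √ε))
      ≤ C₂ * ε ^ (min s' 2 / 2) *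
        (Real.exp (κ / 2 * b) * layer x (κ / 2) ε a * Real.exp (κ * (|ℓ| / √ε))) := by gcongr
    _ = C₂ * Real.exp (κ / 2 * b) * (ε ^ (min s' 2 / 2) * layer x (κ / 2) ε a) *
        Real.exp (κ * (|ℓ| / √ε)) := by ring
    _ ≤ _ := by
        gcongr
        · exact le_add_of_nonneg_left hC₁
        · exact le_add_of_nonneg_left (by positivity)

theorem exists_isBoundaryBound (hδ : 0 < δ) (hL : 0 < L) (hs' : 0 ≤ s') (hss' : s' ≤ s)
    (hx : StrictMono x) (hx01 : ∀ i, x i ∈ Ioc (0 : ℝ) 1)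
    (hper : ∀ a b : ℝ, u₀ (a + 1, b) = u₀ (a, b)) (hglobal : MemSobolevInf s' (undamaged δ) u₀)
    (hlocal : ∀ i, MemSobolevInf s (between δ L x i) u₀) (hΛ : 0 ≤ Λ) (hκ : 0 < κ) :
    ∃ C, 0 < C ∧ ∀ ε c a, ε ≤ δ → |c| ≤ Λ → ∃ β, IsBoundaryBound s s' κ x u₀ C ε c a β := by
  choose C between_bound using fun i ↦ exists_isBoundaryBound_of_mem_Ioo hδ hL hs' hss' hΛ hκ
    (leftTip_lt hx hx01 i) hglobal (hlocal i)
  obtain ⟨C', tip_bound⟩ := exists_isBoundaryBound_tip (s := s) (x := x) hδ hs' hΛ hκ hglobal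
  obtain ⟨B, hB⟩ := Finite.exists_le C
  refine ⟨max 1 (max B C'), by positivity, fun ε c a hεδ hc ↦ ?_⟩
  obtain ⟨n, ⟨i, hi⟩ | ⟨i, hi⟩⟩ := exists_eq_or_mem_Ioo_leftTip hx01 a
  · obtain ⟨β, hβ⟩ := tip_bound ε c i hεδ hc
    rw [← hi] at hβ
    exact ⟨β, (hβ.mono (by simp)).of_sub_intCast hper⟩
  · obtain ⟨β, hβ⟩ := between_bound i ε c (a - n) hεδ hc hi
    exact ⟨β, (hβ.mono (by simp [hB i])).of_sub_intCast hper⟩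

end BoundaryLayers

/-! ### Pointwise error -/

section PointwiseError

variable {M : ℕ} {δ L Λ r s s' C β b a : ℝ} {x : Fin M → ℝ} {u₀ : ℝ × ℝ → ℝ}
  {S : Finset (ℝ × ℝ)} {ω : ℝ × ℝ → ℝ} {N : ℕ} [NeZero N] {u : ℤ × ℤ → ℝ} {z : ℤ × ℤ}

theorem Admissible.average_affine_foot (hS : Admissible r S ω) (h b β a : ℝ) (z : ℤ × ℤ) :
    average S ω (fun ζ ↦ b + β * (foot h (invSlope S ω) ζ - a)) z =
      b + β * (foot h (invSlope S ω) z - a) := by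
  have split : (fun ζ ↦ b + β * (foot h (invSlope S ω) ζ - a)) =
      (fun ζ : ℤ × ℤ ↦ (b - β * a) + 0 * (ζ.1 : ℝ) + 0 * (ζ.2 : ℝ)) +
        β • foot h (invSlope S ω) := by
    ext ζ
    simp only [Pi.add_apply, Pi.smul_apply, smul_eq_mul]
    ring
  rw [split, map_add, map_smul, Pi.add_apply, Pi.smul_apply, hS.average_foot,
    average_affine hS.mass_pos.ne', smul_eq_mul]
  ring

theorem abs_sub_affine_le (v b β t : ℝ) : |v - (b + β * t)| ≤ (|v| + |b| + |β|) * (1 + |t|) := by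
  calc |v - (b + β * t)| ≤ |v| + (|b| + |β| * |t|) :=
        (abs_sub _ _).trans (add_le_add_right ((abs_add_le _ _).trans_eq (by rw [abs_mul])) _)
    _ ≤ |v| + (|b| + |β| * |t|) + (|β| + (|v| + |b|) * |t|) :=
        le_add_of_nonneg_right (by positivity)
    _ = (|v| + |b| + |β|) * (1 + |t|) := by ring

theorem HPeriodic.exists_abs_sub_affine_le (hu : HPeriodic N u) (h c b β a : ℝ) :
    ∃ C, ∀ z : ℤ × ℤ, 1 ≤ z.2 → z.2 ≤ N →
      |u z - (b + β * (foot h c z - a))| ≤ C * (1 + |foot h c z - a|) := by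
  obtain ⟨D, hD⟩ := hu.exists_abs_le 1 N
  refine ⟨D + |b| + |β|, fun z h1 h2 ↦ (abs_sub_affine_le ..).trans ?_⟩
  gcongr
  exact hD z h1 h2

theorem Admissible.abs_foot_sub_le (hS : Admissible r S ω) (hΛ : 1 ≤ Λ) (hrδ : r * (1 / N) ≤ δ)
    (hg : r ≤ Λ * |(S.centerMass ω id).2|) (hC : 0 < C) (hu_per : HPeriodic N u)
    (hu_data : ∀ z : ℤ × ℤ, z.2 ≤ 0 → u z = u₀ ((z.1 : ℝ) / N, (z.2 : ℝ) / N))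
    (hu : ∀ z : ℤ × ℤ, 1 ≤ z.2 → z.2 ≤ N → average S ω u z = u z)
    (ha : foot (1 / N) (invSlope S ω) z = a)
    (hβ : IsBoundaryBound s s' (rate Λ δ) x u₀ C (r * (1 / N)) (invSlope S ω) a β)
    (hz1 : 1 ≤ z.2) (hzN : z.2 ≤ N) :
    |u₀ (a, 0) - u z| ≤ 2 * Real.exp (1 + δ) * (C * ((r * (1 / N)) ^ (min s 2 / 2) +
      (r * (1 / N)) ^ (min s' 2 / 2) * layer x (rate Λ δ / 2) (r * (1 / N)) a)) := by
  have hN : (0 : ℝ) < N := Nat.cast_pos.2 (NeZero.pos N)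
  have hr : 0 < r := zero_lt_one.trans_le hS.one_le
  have hlayer := layer_nonneg x (rate Λ δ / 2) (r * (1 / N)) a
  set V : ℤ × ℤ → ℝ := fun ζ ↦ u ζ - (u₀ (a, 0) + β * (foot (1 / N) (invSlope S ω) ζ - a))
  have harmonic : ∀ ζ : ℤ × ℤ, 1 ≤ ζ.2 → ζ.2 ≤ N → average S ω V ζ = V ζ := by
    intro ζ h1 h2
    calc average S ω V ζ = average S ω u ζ - average S ω
          (fun ζ ↦ u₀ (a, 0) + β * (foot (1 / N) (invSlope S ω) ζ - a)) ζ :=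
        congrFun (map_sub (average S ω) u _) ζ
      _ = V ζ := by rw [hu ζ h1 h2, hS.average_affine_foot]
  have boundary : ∀ ζ : ℤ × ℤ, -r < ζ.2 → ζ.2 ≤ 0 → |V ζ| ≤ C * ((r * (1 / N)) ^ (min s 2 / 2) +
      (r * (1 / N)) ^ (min s' 2 / 2) * layer x (rate Λ δ / 2) (r * (1 / N)) a) *
      Real.exp (rate Λ δ * (|foot (1 / N) (invSlope S ω) ζ - a| / √(r * (1 / N)))) := by
    intro ζ h1 h2
    have in_strip : ((ζ.1 : ℝ) / N, (ζ.2 : ℝ) / N) ∈ undamaged (r * (1 / N)) := by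
      refine ⟨?_, div_nonpos_of_nonpos_of_nonneg (by exact_mod_cast h2) hN.le⟩
      simpa only [mul_one_div, neg_div] using div_lt_div_of_pos_right h1 hN
    have foot_eq : (ζ.1 : ℝ) / N - invSlope S ω * ((ζ.2 : ℝ) / N) =
        foot (1 / N) (invSlope S ω) ζ := by
      rw [foot]; ring
    simpa only [V, foot_eq, hu_data ζ h2, ← sub_sub] using hβ _ in_strip
  have error := hS.abs_le_of_boundary hΛ (by positivity) hrδ
    (mul_one_div_cancel hN.ne').le hg (by positivity) harmonic
    (hu_per.exists_abs_sub_affine_le ..) boundary hz1 hzN ha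
  rwa [abs_sub_comm, show u z - u₀ (a, 0) = V z by simp only [V, ha, sub_self, mul_zero, add_zero]]

theorem exists_pointwise_error [NeZero M] (hδ : 0 < δ) (hL : 0 < L) (hs' : 0 ≤ s')
    (hss' : s' ≤ s) (hx : StrictMono x) (hx01 : ∀ i, x i ∈ Ioc (0 : ℝ) 1)
    (hper : ∀ a b : ℝ, u₀ (a + 1, b) = u₀ (a, b)) (hglobal : MemSobolevInf s' (undamaged δ) u₀)
    (hlocal : ∀ i, MemSobolevInf s (between δ L x i) u₀) (hΛ : 1 ≤ Λ) :
    ∃ C κ, 0 < C ∧ 0 < κ ∧ ∀ (r : ℝ) (N : ℕ) [NeZero N] (S : Finset (ℝ × ℝ)) (ω : ℝ × ℝ → ℝ)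
      (u : ℤ × ℤ → ℝ), Admissible r S ω → r * (1 / N) ≤ δ →
      r ≤ Λ * |(S.centerMass ω id).2| → HPeriodic N u →
      (∀ z : ℤ × ℤ, z.2 ≤ 0 → u z = u₀ ((z.1 : ℝ) / N, (z.2 : ℝ) / N)) →
      (∀ z : ℤ × ℤ, 1 ≤ z.2 → z.2 ≤ N → average S ω u z = u z) →
      ∀ z : ℤ × ℤ, 1 ≤ z.2 → z.2 ≤ N → |u₀ (foot (1 / N) (invSlope S ω) z, 0) - u z| ≤
        C * ((r * (1 / N)) ^ (min s 2 / 2) + (r * (1 / N)) ^ (min s' 2 / 2) *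
          layer x κ (r * (1 / N)) (foot (1 / N) (invSlope S ω) z)) := by
  obtain ⟨C, hC, bound⟩ := exists_isBoundaryBound hδ hL hs' hss' hx hx01 hper hglobal hlocal
    (zero_le_one.trans hΛ) (rate_pos hΛ δ)
  refine ⟨2 * Real.exp (1 + δ) * C, rate Λ δ / 2, by positivity, half_pos (rate_pos hΛ δ), ?_⟩
  intro r N _ S ω u hS hrδ hg hu_per hu_data hu z hz1 hzN
  obtain ⟨β, hβ⟩ := bound _ _ (foot (1 / N) (invSlope S ω) z) hrδ (hS.abs_invSlope_le hg)
  exact (hS.abs_foot_sub_le hΛ hrδ hg hC hu_per hu_data hu rfl hβ hz1 hzN).trans_eq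
    (mul_assoc ..).symm

end PointwiseError

/-! ### Sums over the boundary layers -/

section LayerSums

theorem sum_pow_natAbs_le {ι : Type*} (J : Finset ι) {f : ι → ℤ} (hf : Set.InjOn f J) {ρ : ℝ}
    (h0 : 0 ≤ ρ) (h1 : ρ < 1) : ∑ j ∈ J, ρ ^ (f j).natAbs ≤ 2 * (1 - ρ)⁻¹ := by
  classical
  have half : ∀ J' : Finset ι, Set.InjOn (fun j ↦ (f j).natAbs) J' →
      ∑ j ∈ J', ρ ^ (f j).natAbs ≤ (1 - ρ)⁻¹ := by
    intro J' hinj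
    rw [← Finset.sum_image (f := fun n : ℕ ↦ ρ ^ n) (g := fun j ↦ (f j).natAbs)
      (fun i hi j hj h ↦ hinj hi hj h), ← tsum_geometric_of_lt_one h0 h1]
    exact (summable_geometric_of_lt_one h0 h1).sum_le_tsum _ fun n _ ↦ pow_nonneg h0 n
  rw [← Finset.sum_filter_add_sum_filter_not J (fun j ↦ 0 ≤ f j), two_mul]
  refine add_le_add (half _ ?_) (half _ ?_)
  all_goals
    intro i hi j hj h
    simp only [Finset.coe_filter, mem_ofPred_eq] at hi hj h
    refine hf (Finset.mem_coe.2 hi.1) (Finset.mem_coe.2 hj.1) ?_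
    omega

theorem injOn_sub_mul_sub (N : ℕ) (k : ℤ → ℤ) (c : ℤ) :
    Set.InjOn (fun j ↦ j - N * k j - c) (Finset.Icc 1 (N : ℤ)) := by
  intro i hi j hj h
  simp only [Finset.coe_Icc, mem_Icc] at hi hj h
  have hdvd : (N : ℤ) ∣ i - j := ⟨k i - k j, by linarith⟩
  have := Int.eq_zero_of_abs_lt_dvd hdvd (abs_lt.2 (by omega))
  omega

theorem inv_one_sub_exp_neg_le {μ : ℝ} (hμ : 0 < μ) : (1 - Real.exp (-μ))⁻¹ ≤ 1 + 1 / μ := by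
  have exp_neg_le : Real.exp (-μ) ≤ (μ + 1)⁻¹ := by
    rw [Real.exp_neg]
    gcongr
    exact Real.add_one_le_exp μ
  calc (1 - Real.exp (-μ))⁻¹ ≤ (1 - (μ + 1)⁻¹)⁻¹ := by
        gcongr
        exact sub_pos.2 (inv_lt_one_of_one_lt₀ (by linarith))
    _ = (μ / (μ + 1))⁻¹ := by congr 1; field_simp; ring
    _ = 1 + 1 / μ := by rw [inv_div, add_div, div_self hμ.ne']

theorem sum_exp_neg_norm_le (N : ℕ) [NeZero N] {μ : ℝ} (hμ : 0 < μ) (b : ℝ) :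
    ∑ j ∈ Finset.Icc 1 (N : ℤ), Real.exp (-(μ * (N * ‖((j / N - b : ℝ) : UnitAddCircle)‖))) ≤
      2 * Real.exp μ * (1 + 1 / μ) := by
  have hN : (0 : ℝ) < N := Nat.cast_pos.2 (NeZero.pos N)
  -- Up to the floor, `f j / N` is the representative of `j / N - b` that is closest to zero.
  set f : ℤ → ℤ := fun j ↦ j - N * round ((j : ℝ) / N - b) - ⌊(N : ℝ) * b⌋
  have natAbs_le (j : ℤ) :
      ((f j).natAbs : ℝ) ≤ N * ‖((j / N - b : ℝ) : UnitAddCircle)‖ + 1 := by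
    calc ((f j).natAbs : ℝ)
        = |N * ((j : ℝ) / N - b - round ((j : ℝ) / N - b)) + Int.fract ((N : ℝ) * b)| := by
          rw [Nat.cast_natAbs, Int.cast_abs, Int.fract]
          congr 1
          simp only [f]
          push_cast
          field_simp
          ring
      _ ≤ |N * ((j : ℝ) / N - b - round ((j : ℝ) / N - b))| + 1 := by
          refine (abs_add_le _ _).trans (add_le_add_right ?_ _)
          rw [Int.abs_fract]
          exact (Int.fract_lt_one _).le
      _ = _ := by rw [abs_mul, abs_of_pos hN, UnitAddCircle.norm_eq]
  have term_le (j : ℤ) : Real.exp (-(μ * (N * ‖((j / N - b : ℝ) : UnitAddCircle)‖))) ≤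
      Real.exp μ * Real.exp (-μ) ^ (f j).natAbs := by
    rw [← Real.exp_nat_mul, ← Real.exp_add, Real.exp_le_exp]
    linarith [mul_le_mul_of_nonneg_left (natAbs_le j) hμ.le]
  calc ∑ j ∈ Finset.Icc 1 (N : ℤ), Real.exp (-(μ * (N * ‖((j / N - b : ℝ) : UnitAddCircle)‖)))
      ≤ ∑ j ∈ Finset.Icc 1 (N : ℤ), Real.exp μ * Real.exp (-μ) ^ (f j).natAbs :=
        Finset.sum_le_sum fun j _ ↦ term_le j
    _ ≤ Real.exp μ * (2 * (1 + 1 / μ)) := by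
        rw [← Finset.mul_sum]
        gcongr
        refine (sum_pow_natAbs_le _ (injOn_sub_mul_sub N _ _) (Real.exp_pos _).le
          (Real.exp_lt_one_iff.2 (neg_lt_zero.2 hμ))).trans ?_
        gcongr
        exact inv_one_sub_exp_neg_le hμ
    _ = _ := by ring

variable {κ δ p ε a : ℝ} {M : ℕ} {x : Fin M → ℝ}

theorem exists_sum_exp_neg_norm_div_sqrt_le (hκ : 0 < κ) (hδ : 0 < δ) :
    ∃ C, 0 < C ∧ ∀ (N : ℕ) [NeZero N] (ε b : ℝ), 1 / (N : ℝ) ≤ ε → ε ≤ δ →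
      ∑ j ∈ Finset.Icc 1 (N : ℤ),
        Real.exp (-(κ * (‖((j / N - b : ℝ) : UnitAddCircle)‖ / √ε))) * (1 / N) ≤ C * √ε := by
  refine ⟨2 * Real.exp (κ * √δ) * (√δ + 1 / κ), by positivity, fun N _ ε b hNε hεδ ↦ ?_⟩
  have hN : (0 : ℝ) < N := Nat.cast_pos.2 (NeZero.pos N)
  have hε : 0 < ε := (one_div_pos.2 hN).trans_le hNε
  have hσ : 0 < √ε := Real.sqrt_pos.2 hε
  have h_le : 1 / (N : ℝ) ≤ √ε * √δ := by
    calc 1 / (N : ℝ) ≤ √ε * √ε := hNε.trans_eq (Real.mul_self_sqrt hε.le).symm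
      _ ≤ √ε * √δ := by gcongr
  set μ := κ * ((1 / N) / √ε) with hμ
  have μ_le : μ ≤ κ * √δ := by
    rw [hμ]
    gcongr
    exact (div_le_iff₀' hσ).2 h_le
  have rescale (t : ℝ) : κ * (t / √ε) = μ * (N * t) := by rw [hμ]; field_simp
  simp only [rescale]
  calc ∑ j ∈ Finset.Icc 1 (N : ℤ),
        Real.exp (-(μ * (N * ‖((j / N - b : ℝ) : UnitAddCircle)‖))) * (1 / N)
      ≤ 2 * Real.exp μ * (1 + 1 / μ) * (1 / N) := by
        rw [← Finset.sum_mul]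
        gcongr
        exact sum_exp_neg_norm_le N (by positivity) b
    _ = 2 * Real.exp μ * (1 / N + √ε / κ) := by rw [hμ]; field_simp
    _ ≤ 2 * Real.exp (κ * √δ) * (√ε * √δ + √ε / κ) := by gcongr
    _ = _ := by ring

theorem layer_le_one (hκ : 0 ≤ κ) : layer x κ ε a ≤ 1 :=
  Real.exp_le_one_iff.2 (neg_nonpos.2
    (mul_nonneg hκ (div_nonneg (tipDist_nonneg x a) (Real.sqrt_nonneg ε))))

theorem layer_rpow_le_sum [NeZero M] (x : Fin M → ℝ) (κ p ε a : ℝ) :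
    layer x κ ε a ^ p ≤
      ∑ i, Real.exp (-(κ * p * (‖((a - x i : ℝ) : UnitAddCircle)‖ / √ε))) := by
  obtain ⟨-, ⟨i, rfl⟩, hi⟩ := (finite_range fun i ↦ (x i : UnitAddCircle)).isCompact
    |>.exists_infDist_eq_dist (range_nonempty _) (a : UnitAddCircle)
  calc layer x κ ε a ^ p = Real.exp (-(κ * p * (‖((a - x i : ℝ) : UnitAddCircle)‖ / √ε))) := by
        rw [layer, tipDist, hi, dist_eq_norm, AddCircle.coe_sub, ← Real.exp_mul]
        ring_nf
    _ ≤ _ := Finset.single_le_sum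
        (f := fun i ↦ Real.exp (-(κ * p * (‖((a - x i : ℝ) : UnitAddCircle)‖ / √ε))))
        (fun _ _ ↦ (Real.exp_pos _).le) (Finset.mem_univ i)

theorem exists_sum_layer_rpow_le [NeZero M] (x : Fin M → ℝ) (hκ : 0 < κ) (hδ : 0 < δ)
    (hp : 0 < p) :
    ∃ C, 0 < C ∧ ∀ (N : ℕ) [NeZero N] (ε c : ℝ), 1 / (N : ℝ) ≤ ε → ε ≤ δ →
      ∑ z ∈ pixels N, layer x κ ε (foot (1 / N) c z) ^ p * (1 / (N : ℝ)) ^ 2 ≤ C * √ε := by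
  obtain ⟨C, hC, row_sum⟩ := exists_sum_exp_neg_norm_div_sqrt_le (mul_pos hκ hp) hδ
  have hM : (0 : ℝ) < M := Nat.cast_pos.2 (NeZero.pos M)
  refine ⟨M * C, by positivity, fun N _ ε c hNε hεδ ↦ ?_⟩
  have hN : (N : ℝ) ≠ 0 := NeZero.ne _
  have foot_sub (i : Fin M) (j m : ℤ) :
      foot (1 / N) c (j, m) - x i = (j : ℝ) / N - (c * m / N + x i) := by
    rw [foot]; ring
  calc ∑ z ∈ pixels N, layer x κ ε (foot (1 / N) c z) ^ p * (1 / (N : ℝ)) ^ 2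
      ≤ ∑ z ∈ pixels N, ∑ i, Real.exp
          (-(κ * p * (‖((foot (1 / N) c z - x i : ℝ) : UnitAddCircle)‖ / √ε))) *
            (1 / (N : ℝ)) ^ 2 := by
        gcongr with z _
        rw [← Finset.sum_mul]
        gcongr
        exact layer_rpow_le_sum ..
    _ = ∑ i, ∑ m ∈ Finset.Icc 1 (N : ℤ), (∑ j ∈ Finset.Icc 1 (N : ℤ),
          Real.exp (-(κ * p * (‖((j / N - (c * m / N + x i) : ℝ) : UnitAddCircle)‖ / √ε))) *
            (1 / N)) * (1 / N) := by
        rw [Finset.sum_comm]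
        simp only [pixels, Finset.sum_product_right, foot_sub, Finset.sum_mul, mul_assoc, sq]
    _ ≤ ∑ _i : Fin M, ∑ _m ∈ Finset.Icc 1 (N : ℤ), C * √ε * (1 / N) := by
        gcongr with i _ m _
        exact row_sum N ε _ hNε hεδ
    _ = M * C * √ε := by
        simp only [Finset.sum_const, Int.card_Icc, Finset.card_univ, Fintype.card_fin, nsmul_eq_mul,
          add_sub_cancel_right, Int.toNat_natCast]
        field_simp

end LayerSums

/-! ### Discrete norms -/

section DiscreteNorm

variable {N : ℕ} {p q : ℝ≥0∞} {f g lam : ℤ × ℤ → ℝ} {z : ℤ × ℤ} {t t' ε δ d b C C' : ℝ}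

theorem sum_pixels_one_div_sq (N : ℕ) [NeZero N] : ∑ _z ∈ pixels N, (1 / (N : ℝ)) ^ 2 = 1 := by
  have hN : (N : ℝ) ≠ 0 := NeZero.ne _
  simp only [pixels, Finset.sum_const, Finset.card_product, Int.card_Icc, add_sub_cancel_right,
    Int.toNat_natCast, nsmul_eq_mul, Nat.cast_mul]
  field_simp

theorem discreteNorm_top_nonneg (N : ℕ) (f : ℤ × ℤ → ℝ) : 0 ≤ discreteNorm N ∞ f := by
  rw [discreteNorm, if_pos rfl]
  exact NNReal.coe_nonneg _

theorem abs_le_discreteNorm_top (hz : z ∈ pixels N) : |f z| ≤ discreteNorm N ∞ f := by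
  rw [discreteNorm, if_pos rfl, ← Real.norm_eq_abs, ← coe_nnnorm, NNReal.coe_le_coe]
  exact Finset.le_sup (f := fun z ↦ ‖f z‖₊) hz

theorem discreteNorm_top_le (hb : 0 ≤ b) (h : ∀ z ∈ pixels N, |f z| ≤ b) :
    discreteNorm N ∞ f ≤ b := by
  rw [discreteNorm, if_pos rfl, ← Real.coe_toNNReal b hb, NNReal.coe_le_coe]
  refine Finset.sup_le fun z hz ↦ ?_
  rw [← NNReal.coe_le_coe, Real.coe_toNNReal b hb, coe_nnnorm, Real.norm_eq_abs]
  exact h z hz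

theorem discreteNorm_le_mul (hp : 0 < p) (hC : 0 ≤ C)
    (h : ∀ z ∈ pixels N, |f z| ≤ C * |g z|) : discreteNorm N p f ≤ C * discreteNorm N p g := by
  rcases eq_or_ne p ∞ with rfl | hp_top
  · refine discreteNorm_top_le (mul_nonneg hC (discreteNorm_top_nonneg N g)) fun z hz ↦ ?_
    exact (h z hz).trans (by gcongr; exact abs_le_discreteNorm_top hz)
  have hp' : 0 < p.toReal := ENNReal.toReal_pos hp.ne' hp_top
  rw [discreteNorm, discreteNorm, if_neg hp_top, if_neg hp_top]
  calc (∑ z ∈ pixels N, |f z| ^ p.toReal * (1 / (N : ℝ)) ^ 2) ^ (1 / p.toReal)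
      ≤ (∑ z ∈ pixels N, (C * |g z|) ^ p.toReal * (1 / (N : ℝ)) ^ 2) ^ (1 / p.toReal) := by
        gcongr with z hz
        exact h z hz
    _ = (C ^ p.toReal * ∑ z ∈ pixels N, |g z| ^ p.toReal * (1 / (N : ℝ)) ^ 2) ^
        (1 / p.toReal) := by
        simp only [Real.mul_rpow hC (abs_nonneg _), mul_assoc, Finset.mul_sum]
    _ = _ := by
        rw [Real.mul_rpow (by positivity) (Finset.sum_nonneg fun _ _ ↦ by positivity),
          ← Real.rpow_mul hC, mul_one_div_cancel hp'.ne', Real.rpow_one]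

theorem discreteNorm_le_discreteNorm_top [NeZero N] (hp : 0 < p) (f : ℤ × ℤ → ℝ) :
    discreteNorm N p f ≤ discreteNorm N ∞ f := by
  rcases eq_or_ne p ∞ with rfl | hp_top
  · exact le_rfl
  refine (discreteNorm_le_mul (g := 1) hp (discreteNorm_top_nonneg N f) fun z hz ↦ ?_).trans_eq ?_
  · simpa using abs_le_discreteNorm_top hz
  · simp only [discreteNorm, if_neg hp_top, Pi.one_apply, abs_one, Real.one_rpow, one_mul,
      sum_pixels_one_div_sq, mul_one]

theorem discreteNorm_mono [NeZero N] (hp : 0 < p) (hpq : p ≤ q) (f : ℤ × ℤ → ℝ) :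
    discreteNorm N p f ≤ discreteNorm N q f := by
  rcases eq_or_ne q ∞ with rfl | hq_top
  · exact discreteNorm_le_discreteNorm_top hp f
  have hp_top : p ≠ ∞ := ne_top_of_le_ne_top hq_top hpq
  have hp' : 0 < p.toReal := ENNReal.toReal_pos hp.ne' hp_top
  have hpq' : p.toReal ≤ q.toReal := ENNReal.toReal_mono hq_top hpq
  have hq' : 0 < q.toReal := hp'.trans_le hpq'
  have jensen := Real.rpow_arith_mean_le_arith_mean_rpow (pixels N) (fun _ ↦ (1 / (N : ℝ)) ^ 2)
    (fun z ↦ |f z| ^ p.toReal) (fun _ _ ↦ by positivity) (sum_pixels_one_div_sq N)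
    (fun _ _ ↦ by positivity) ((one_le_div hp').2 hpq')
  simp only [← Real.rpow_mul (abs_nonneg _), mul_div_cancel₀ _ hp'.ne',
    mul_comm ((1 / (N : ℝ)) ^ 2)] at jensen
  rw [discreteNorm, discreteNorm, if_neg hp_top, if_neg hq_top]
  set m := ∑ z ∈ pixels N, |f z| ^ p.toReal * (1 / (N : ℝ)) ^ 2
  have hm : 0 ≤ m := Finset.sum_nonneg fun _ _ ↦ by positivity
  calc m ^ (1 / p.toReal) = (m ^ (q.toReal / p.toReal)) ^ (1 / q.toReal) := by
        rw [← Real.rpow_mul hm]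
        congr 1
        field_simp
    _ ≤ _ := by gcongr

theorem rpow_le_max_one_mul_rpow {e : ℝ} (hε : 0 < ε) (hεδ : ε ≤ δ) (hbe : b ≤ e)
    (heb : e ≤ b + 1) : ε ^ e ≤ max 1 δ * ε ^ b := by
  refine (rpow_le_mul_rpow hε hεδ hbe).trans ?_
  gcongr
  calc δ ^ (e - b) ≤ max 1 δ ^ (e - b) :=
        Real.rpow_le_rpow (hε.le.trans hεδ) (le_max_right ..) (by linarith)
    _ ≤ max 1 δ ^ (1 : ℝ) := Real.rpow_le_rpow_of_exponent_le (le_max_left ..) (by linarith)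
    _ = max 1 δ := Real.rpow_one _

theorem add_mul_le_mul_max {P l : ℝ} (ht' : 0 ≤ t') (ht2 : t ≤ 2) (hP : 0 ≤ P) (hPt : t' + P ≤ t)
    (hε : 0 < ε) (hεδ : ε ≤ δ) :
    ε ^ (t / 2) + ε ^ (t' / 2) * l ≤ 2 * max 1 δ * ε ^ (t' / 2) * max (ε ^ (P / 2)) l := by
  have smooth : ε ^ (t / 2) ≤ max 1 δ * (ε ^ (t' / 2) * ε ^ (P / 2)) := by
    rw [← Real.rpow_add hε]
    exact rpow_le_max_one_mul_rpow hε hεδ (by linarith) (by linarith)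
  have : 0 ≤ ε ^ (t' / 2) * max (ε ^ (P / 2)) l :=
    mul_nonneg (by positivity) (le_max_of_le_left (by positivity))
  calc ε ^ (t / 2) + ε ^ (t' / 2) * l
      ≤ max 1 δ * (ε ^ (t' / 2) * max (ε ^ (P / 2)) l) +
        1 * (ε ^ (t' / 2) * max (ε ^ (P / 2)) l) := by
        rw [one_mul]
        refine add_le_add (smooth.trans ?_) ?_
        · gcongr
          exact le_max_left ..
        · gcongr
          exact le_max_right ..
    _ ≤ max 1 δ * (ε ^ (t' / 2) * max (ε ^ (P / 2)) l) +
        max 1 δ * (ε ^ (t' / 2) * max (ε ^ (P / 2)) l) := by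
        gcongr
        exact le_max_left ..
    _ = _ := by ring

theorem max_rpow_le {η P P₀ l : ℝ} (hη : 0 < η) (hl0 : 0 ≤ l) (hl1 : l ≤ 1) (hP : P₀ ≤ P) :
    max η l ^ P ≤ η ^ P + l ^ P₀ := by
  rcases max_cases η l with ⟨h, -⟩ | ⟨h, hηl⟩
  · rw [h]
    exact le_add_of_nonneg_right (by positivity)
  · rw [h]
    exact (Real.rpow_le_rpow_of_exponent_ge (hη.trans hηl) hl1 hP).trans
      (le_add_of_nonneg_left (by positivity))

theorem sum_max_rpow_le [NeZero N] {η P P₀ : ℝ} (hη : 0 < η) (hl0 : ∀ z, 0 ≤ lam z)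
    (hl1 : ∀ z, lam z ≤ 1) (hP : P₀ ≤ P) :
    ∑ z ∈ pixels N, max η (lam z) ^ P * (1 / (N : ℝ)) ^ 2 ≤
      η ^ P + ∑ z ∈ pixels N, lam z ^ P₀ * (1 / (N : ℝ)) ^ 2 := by
  calc ∑ z ∈ pixels N, max η (lam z) ^ P * (1 / (N : ℝ)) ^ 2
      ≤ ∑ z ∈ pixels N, (η ^ P + lam z ^ P₀) * (1 / (N : ℝ)) ^ 2 := by
        gcongr with z _
        exact max_rpow_le hη (hl0 z) (hl1 z) hP
    _ = _ := by
        simp only [add_mul, Finset.sum_add_distrib, ← Finset.mul_sum, sum_pixels_one_div_sq,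
          mul_one]

theorem discreteNorm_max_le [NeZero N] (hε : 0 < ε) (hC' : 0 ≤ C') (hl0 : ∀ z, 0 ≤ lam z)
    (hl1 : ∀ z, lam z ≤ 1) (hp : 0 < p) (hpd : (p⁻¹).toReal ≤ d)
    (hsum : 0 < d → ∑ z ∈ pixels N, lam z ^ (1 / d) * (1 / (N : ℝ)) ^ 2 ≤ C' * √ε) :
    discreteNorm N p (fun z ↦ max (ε ^ ((p⁻¹).toReal / 2)) (lam z)) ≤
      (1 + C') ^ d * ε ^ ((p⁻¹).toReal / 2) := by
  have hd : 0 ≤ d := ENNReal.toReal_nonneg.trans hpd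
  have hmax (η : ℝ) (z : ℤ × ℤ) : |max η (lam z)| = max η (lam z) :=
    abs_of_nonneg (le_max_of_le_right (hl0 z))
  rcases eq_or_ne p ∞ with rfl | hp_top
  · simp only [ENNReal.inv_top, ENNReal.toReal_zero, zero_div, Real.rpow_zero, mul_one]
    refine discreteNorm_top_le (by positivity) fun z _ ↦ ?_
    rw [hmax, max_eq_left (hl1 z)]
    exact Real.one_le_rpow (by linarith) hd
  set P := p.toReal
  have hP : 0 < P := ENNReal.toReal_pos hp.ne' hp_top
  rw [ENNReal.toReal_inv, ← one_div] at hpd ⊢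
  have hd : 0 < d := (one_div_pos.2 hP).trans_le hpd
  set η := ε ^ (1 / P / 2)
  have hη : 0 < η := by positivity
  have hηP : η ^ P = √ε := by
    rw [← Real.rpow_mul hε.le, Real.sqrt_eq_rpow]
    congr 1
    field_simp
  have mean_le : ∑ z ∈ pixels N, max η (lam z) ^ P * (1 / (N : ℝ)) ^ 2 ≤ (1 + C') * η ^ P := by
    have := sum_max_rpow_le (N := N) hη hl0 hl1 ((one_div_le hP hd).1 hpd)
    rw [hηP] at this ⊢
    linarith [hsum hd]
  rw [discreteNorm, if_neg hp_top]
  simp only [hmax]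
  calc (∑ z ∈ pixels N, max η (lam z) ^ P * (1 / (N : ℝ)) ^ 2) ^ (1 / P)
      ≤ ((1 + C') * η ^ P) ^ (1 / P) := by gcongr
    _ = (1 + C') ^ (1 / P) * η := by
        rw [Real.mul_rpow (by positivity) (by positivity), ← Real.rpow_mul hη.le,
          mul_one_div_cancel hP.ne', Real.rpow_one]
    _ ≤ (1 + C') ^ d * η := by
        gcongr
        linarith

theorem discreteNorm_le_of_inv_le [NeZero N] (ht' : 0 ≤ t') (ht2 : t ≤ 2) (hε : 0 < ε)
    (hεδ : ε ≤ δ) (hC : 0 ≤ C) (hC' : 0 ≤ C') (hl0 : ∀ z, 0 ≤ lam z) (hl1 : ∀ z, lam z ≤ 1)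
    (hf : ∀ z ∈ pixels N, |f z| ≤ C * (ε ^ (t / 2) + ε ^ (t' / 2) * lam z))
    (hsum : 0 < t - t' →
      ∑ z ∈ pixels N, lam z ^ (1 / (t - t')) * (1 / (N : ℝ)) ^ 2 ≤ C' * √ε)
    (hp : 0 < p) (hpt : t' + (p⁻¹).toReal ≤ t) :
    discreteNorm N p f ≤
      2 * C * max 1 δ * (1 + C') ^ (t - t') * ε ^ (t' / 2 + (p⁻¹).toReal / 2) := by
  calc discreteNorm N p f
      ≤ C * (2 * max 1 δ * ε ^ (t' / 2)) *
        discreteNorm N p (fun z ↦ max (ε ^ ((p⁻¹).toReal / 2)) (lam z)) := by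
        refine discreteNorm_le_mul hp (by positivity) fun z hz ↦ (hf z hz).trans ?_
        rw [mul_assoc, abs_of_nonneg (le_max_of_le_right (hl0 z))]
        gcongr
        exact add_mul_le_mul_max ht' ht2 ENNReal.toReal_nonneg hpt hε hεδ
    _ ≤ C * (2 * max 1 δ * ε ^ (t' / 2)) * ((1 + C') ^ (t - t') * ε ^ ((p⁻¹).toReal / 2)) := by
        gcongr
        exact discreteNorm_max_le hε hC' hl0 hl1 hp (by linarith) hsum
    _ = _ := by rw [Real.rpow_add hε]; ring

theorem discreteNorm_le [NeZero N] (ht' : 0 ≤ t') (htt' : t' ≤ t) (ht2 : t ≤ 2) (hε : 0 < ε)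
    (hεδ : ε ≤ δ) (hC : 0 ≤ C) (hC' : 0 ≤ C') (hl0 : ∀ z, 0 ≤ lam z) (hl1 : ∀ z, lam z ≤ 1)
    (hf : ∀ z ∈ pixels N, |f z| ≤ C * (ε ^ (t / 2) + ε ^ (t' / 2) * lam z))
    (hsum : 0 < t - t' →
      ∑ z ∈ pixels N, lam z ^ (1 / (t - t')) * (1 / (N : ℝ)) ^ 2 ≤ C' * √ε) (hp : 0 < p) :
    discreteNorm N p f ≤ 2 * C * max 1 δ * (1 + C') ^ (t - t') *
      ε ^ min (t' / 2 + (p⁻¹).toReal / 2) (t / 2) := by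
  rcases le_or_gt (t' + (p⁻¹).toReal) t with hpt | hpt
  · rw [min_eq_left (by linarith)]
    exact discreteNorm_le_of_inv_le ht' ht2 hε hεδ hC hC' hl0 hl1 hf hsum hp hpt
  -- For small `p` the bound is the one at the exponent `1 / (t - t')`, by monotonicity in `p`.
  set q := (ENNReal.ofReal (t - t'))⁻¹ with hq
  have q_inv : (q⁻¹).toReal = t - t' := by
    rw [hq, inv_inv, ENNReal.toReal_ofReal (by linarith)]
  have hpq : p ≤ q := ENNReal.le_inv_iff_le_inv.2 <|
    (ENNReal.ofReal_le_iff_le_toReal (ENNReal.inv_ne_top.2 hp.ne')).2 (by linarith)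
  rw [min_eq_right (by linarith)]
  calc discreteNorm N p f ≤ discreteNorm N q f := discreteNorm_mono hp hpq f
    _ ≤ 2 * C * max 1 δ * (1 + C') ^ (t - t') * ε ^ (t' / 2 + (q⁻¹).toReal / 2) :=
        discreteNorm_le_of_inv_le ht' ht2 hε hεδ hC hC' hl0 hl1 hf hsum (hp.trans_le hpq)
          (by linarith)
    _ = _ := by rw [q_inv]; ring_nf

end DiscreteNorm

/-! ### The limit image and the error constant -/

theorem cot_lineAngle {g : ℝ × ℝ} (hg : g.2 ≠ 0) : Real.cot (lineAngle g) = g.1 / g.2 := by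
  set ζ : ℂ := ⟨g.1, g.2⟩
  have hζ : ζ ≠ 0 := fun h ↦ hg (congrArg Complex.im h)
  have angle_eq : lineAngle g = ζ.arg - (toIcoDiv Real.pi_pos 0 ζ.arg : ℝ) * Real.pi := by
    rw [lineAngle, toIcoMod, zsmul_eq_mul]
  rw [Real.cot_eq_cos_div_sin, angle_eq, Real.cos_sub_int_mul_pi, Real.sin_sub_int_mul_pi,
    mul_div_mul_left _ _ (zpow_ne_zero _ (by norm_num)), Complex.cos_arg hζ, Complex.sin_arg,
    div_div_div_cancel_right₀ (norm_ne_zero_iff.2 hζ)]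

theorem lineAngle_mem_Ico (g : ℝ × ℝ) : lineAngle g ∈ Ico 0 Real.pi := by
  simpa only [lineAngle, zero_add] using toIcoMod_mem_Ico Real.pi_pos 0 (Complex.arg ⟨g.1, g.2⟩)

theorem map_transport {u₀ : ℝ × ℝ → ℝ} (hper : ∀ a b : ℝ, u₀ (a + 1, b) = u₀ (a, b)) (θ : ℝ)
    (N : ℕ) (z : ℤ × ℤ) :
    u₀ (transport θ ((z.1 : ℝ) / N, (z.2 : ℝ) / N)) = u₀ (foot (1 / N) (Real.cot θ) z, 0) := by
  have foot_eq : (z.1 : ℝ) / N - Real.cot θ * ((z.2 : ℝ) / N) = foot (1 / N) (Real.cot θ) z := by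
    rw [foot]; ring
  rw [transport, foot_eq, toIocMod, zsmul_eq_mul, mul_one, map_sub_intCast hper]

theorem error_exponent_eq {s s' P : ℝ} (hss' : s' ≤ s) (hP : 0 ≤ P) :
    min (min (s' / 2 + P / 2) (s / 2)) 1 = min (min s' 2 / 2 + P / 2) (min s 2 / 2) := by
  grind

theorem exists_error_bound {M : ℕ} [NeZero M] {δ L Λ s s' : ℝ} {x : Fin M → ℝ} {u₀ : ℝ × ℝ → ℝ}
    (hδ : 0 < δ) (hL : 0 < L) (hs' : 0 ≤ s') (hss' : s' ≤ s) (hx : StrictMono x)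
    (hx01 : ∀ i, x i ∈ Ioc (0 : ℝ) 1) (hper : ∀ a b : ℝ, u₀ (a + 1, b) = u₀ (a, b))
    (hglobal : MemSobolevInf s' (undamaged δ) u₀)
    (hlocal : ∀ i, MemSobolevInf s (between δ L x i) u₀) (hΛ : 1 ≤ Λ) :
    ∃ C, ∀ (method : Method) (r : ℝ) (N : ℕ) [NeZero N] (A : Finset (ℝ × ℝ)) (w : ℝ × ℝ → ℝ)
      (u : ℤ × ℤ → ℝ), Admissible r (stencil method A) (fun y ↦ w (r⁻¹ • y)) →
      r * (1 / (N : ℝ)) ≤ δ → r / |(centerOfMass method r A w).2| ≤ Λ →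
      IsInpainted method N r A w u₀ u → ∀ p : ℝ≥0∞, 0 < p →
        discreteNorm N p (fun z ↦ u₀ (transport (lineAngle (centerOfMass method r A w))
          ((z.1 : ℝ) / N, (z.2 : ℝ) / N)) - u z) ≤
        C * (r * (1 / (N : ℝ))) ^ min (min (s' / 2 + (p⁻¹).toReal / 2) (s / 2)) 1 := by
  obtain ⟨C, κ, hC, hκ, pointwise⟩ :=
    exists_pointwise_error hδ hL hs' hss' hx hx01 hper hglobal hlocal hΛ
  set d := min s 2 - min s' 2
  obtain ⟨C', hC', hsum⟩ : ∃ C', 0 ≤ C' ∧ ∀ (N : ℕ) [NeZero N] (ε c : ℝ), 1 / (N : ℝ) ≤ ε →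
      ε ≤ δ → 0 < d → ∑ z ∈ pixels N, layer x κ ε (foot (1 / N) c z) ^ (1 / d) *
        (1 / (N : ℝ)) ^ 2 ≤ C' * √ε := by
    by_cases hd : 0 < d
    · obtain ⟨C', hC', bound⟩ := exists_sum_layer_rpow_le x hκ hδ (one_div_pos.2 hd)
      exact ⟨C', hC'.le, fun N _ ε c hNε hεδ _ ↦ bound N ε c hNε hεδ⟩
    · exact ⟨0, le_rfl, fun _ _ _ _ _ _ h ↦ absurd h hd⟩
  refine ⟨2 * C * max 1 δ * (1 + C') ^ d, fun method r N _ A w u hS hrδ hg hu p hp ↦ ?_⟩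
  have hN : (0 : ℝ) < N := Nat.cast_pos.2 (NeZero.pos N)
  have hNr : 1 / (N : ℝ) ≤ r * (1 / N) := le_mul_of_one_le_left (by positivity) hS.one_le
  have hg₂ : (centerOfMass method r A w).2 ≠ 0 := hS.drift.ne
  set c := invSlope (stencil method A) fun y ↦ w (r⁻¹ • y)
  have limit (z : ℤ × ℤ) : u₀ (transport (lineAngle (centerOfMass method r A w))
      ((z.1 : ℝ) / N, (z.2 : ℝ) / N)) = u₀ (foot (1 / N) c z, 0) := by
    rw [map_transport hper, cot_lineAngle hg₂]
    rfl
  simp only [limit]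
  rw [error_exponent_eq hss' ENNReal.toReal_nonneg]
  refine discreteNorm_le (le_min hs' zero_le_two) (min_le_min_right _ hss') (min_le_right _ _)
    ((one_div_pos.2 hN).trans_le hNr) hrδ hC.le hC' (fun z ↦ layer_nonneg ..)
    (fun z ↦ layer_le_one hκ.le) (fun z hz ↦ ?_) (hsum N _ c hNr hrδ) hp
  simp only [pixels, Finset.mem_product, Finset.mem_Icc] at hz
  exact pointwise r N _ _ u hS hrδ ((div_le_iff₀ (abs_pos.2 hg₂)).1 hg) hu.hperiodic
    (fun z ↦ hu.eq_data) (fun z ↦ hu.average_eq hS) z hz.2.1 hz.2.2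

theorem mul_le_of_lt_div_add_two {r h δ : ℝ} (hr : 1 ≤ r) (hh : 0 ≤ h) (hδ : h < δ / (r + 2)) :
    r * h ≤ δ := by
  rw [lt_div_iff₀ (by linarith)] at hδ
  linarith

section ErrorConstant

open MeasureTheory

theorem intervalIntegral_add_one_monotone {G : ℝ → ℝ} (hG : Monotone G) :
    Monotone fun t ↦ ∫ τ in t..t + 1, G τ := by
  intro a b hab
  have shift (t : ℝ) : ∫ τ in t..t + 1, G τ = ∫ τ in (0 : ℝ)..1, G (τ + t) := by
    rw [intervalIntegral.integral_comp_add_right, zero_add, add_comm]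
  have integrable (t : ℝ) : IntervalIntegrable (fun τ ↦ G (τ + t)) volume 0 1 :=
    (hG.comp fun _ _ h ↦ add_le_add_left h t).intervalIntegrable
  simp only [shift]
  exact intervalIntegral.integral_mono_on zero_le_one (integrable a) (integrable b)
    fun τ _ ↦ hG (by linarith)

theorem exists_continuous_strictMono_majorant {G : ℝ → ℝ} (hG : Monotone G) :
    ∃ F : ℝ → ℝ, Continuous F ∧ StrictMono F ∧ G ≤ F := by
  have integrable (a b : ℝ) : IntervalIntegrable G volume a b := hG.intervalIntegrable
  have primitive := intervalIntegral.continuous_primitive integrable 0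
  refine ⟨fun t ↦ Real.exp t + ∫ τ in t..t + 1, G τ, ?_,
    Real.exp_strictMono.add_monotone (intervalIntegral_add_one_monotone hG), fun t ↦ ?_⟩
  · exact Real.continuous_exp.add
      (((primitive.comp (continuous_id.add continuous_const)).sub primitive).congr fun t ↦
        intervalIntegral.integral_interval_sub_left (integrable 0 _) (integrable 0 t))
  · calc G t = ∫ _τ in t..t + 1, G t := by simp
      _ ≤ ∫ τ in t..t + 1, G τ :=
        intervalIntegral.integral_mono_on (by linarith) (by simp) (integrable _ _)
          fun τ hτ ↦ hG hτ.1
      _ ≤ _ := le_add_of_nonneg_left (Real.exp_pos t).le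

theorem tendsto_inv_sin_atTop {l : Filter ℝ} {a : ℝ} (ha : Real.sin a = 0) (hl : l ≤ 𝓝 a)
    (hmem : Ioo 0 Real.pi ∈ l) : Tendsto (fun θ ↦ (Real.sin θ)⁻¹) l atTop := by
  refine tendsto_inv_nhdsGT_zero.comp (tendsto_nhdsWithin_iff.2 ⟨?_, ?_⟩)
  · simpa only [ha] using (Real.continuous_sin.tendsto a).mono_left hl
  · filter_upwards [hmem] with θ hθ using Real.sin_pos_of_mem_Ioo hθ

theorem exists_error_constant (f : ℕ → ℝ) :
    ∃ K : ℝ → ℝ → ℝ,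
      ContinuousOn (Function.uncurry K) (Ioi (0 : ℝ) ×ˢ Ioo 0 Real.pi) ∧
      (∀ θ ∈ Ioo 0 Real.pi, StrictMonoOn (fun ρ ↦ K ρ θ) (Ioi (0 : ℝ))) ∧
      (∀ ρ : ℝ, 0 < ρ → Tendsto (K ρ) (𝓝[>] 0) atTop ∧ Tendsto (K ρ) (𝓝[<] Real.pi) atTop) ∧
      ∀ ρ, ∀ θ ∈ Ico 0 Real.pi, f ⌈ρ⌉₊ ≤ K ρ θ := by
  obtain ⟨F, hcont, hmono, hF⟩ :=
    exists_continuous_strictMono_majorant ((partialSups f).monotone.comp Nat.ceil_mono)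
  refine ⟨fun ρ θ ↦ F ρ + (Real.sin θ)⁻¹, ?_, ?_, fun ρ _ ↦ ⟨?_, ?_⟩, fun ρ θ hθ ↦ ?_⟩
  · exact (hcont.comp continuous_fst).continuousOn.add
      ((Real.continuous_sin.comp continuous_snd).continuousOn.inv₀
        fun q hq ↦ (Real.sin_pos_of_mem_Ioo hq.2).ne')
  · exact fun θ _ ↦ (hmono.add_const _).strictMonoOn _
  · exact tendsto_atTop_add_const_left _ _
      (tendsto_inv_sin_atTop Real.sin_zero nhdsWithin_le_nhds (Ioo_mem_nhdsGT Real.pi_pos))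
  · exact tendsto_atTop_add_const_left _ _
      (tendsto_inv_sin_atTop Real.sin_pi nhdsWithin_le_nhds (Ioo_mem_nhdsLT Real.pi_pos))
  · exact ((le_partialSups f _).trans (hF ρ)).trans (le_add_of_nonneg_right
      (inv_nonneg.2 (Real.sin_nonneg_of_nonneg_of_le_pi hθ.1 hθ.2.le)))

end ErrorConstant

end Inpainting

theorem theorem1
    (δ L s s' : ℝ) (hδ : 0 < δ) (hL : 0 < L) (hs : 0 < s) (hs' : 0 ≤ s') (hss' : s' ≤ s)
    (M : ℕ) [NeZero M] (x : Fin M → ℝ) (hx : StrictMono x) (hx01 : ∀ i, x i ∈ Set.Ioc (0 : ℝ) 1)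
    (u₀ : ℝ × ℝ → ℝ) (hper : ∀ a b : ℝ, u₀ (a + 1, b) = u₀ (a, b))
    (hglobal : Inpainting.MemSobolevInf s' (Inpainting.undamaged δ) u₀)
    (hlocal : ∀ i, Inpainting.MemSobolevInf s (Inpainting.between δ L x i) u₀) :
    ∃ K : ℝ → ℝ → ℝ,
      ContinuousOn (Function.uncurry K) (Set.Ioi (0 : ℝ) ×ˢ Set.Ioo 0 Real.pi) ∧
      (∀ θ ∈ Set.Ioo 0 Real.pi, StrictMonoOn (fun ρ => K ρ θ) (Set.Ioi (0 : ℝ))) ∧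
      (∀ ρ : ℝ, 0 < ρ → Tendsto (K ρ) (𝓝[>] 0) atTop ∧ Tendsto (K ρ) (𝓝[<] Real.pi) atTop) ∧
      ∀ (method : Inpainting.Method) (r : ℝ) (_ : 1 ≤ r)
        (N : ℕ) (_ : 0 < N) (_ : 1 / (N : ℝ) < δ / (r + 2))
        (A : Finset (ℝ × ℝ)) (_ : ∀ y ∈ A, y.1 ^ 2 + y.2 ^ 2 ≤ r ^ 2)
        (w : ℝ × ℝ → ℝ) (_ : ∀ y, 0 ≤ w y)
        (_ : 0 < Inpainting.totalMass method r A w)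
        (g : ℝ × ℝ) (_ : g = Inpainting.centerOfMass method r A w) (_ : g.2 ≠ 0),
        (∃! u : ℤ × ℤ → ℝ, Inpainting.IsInpainted method N r A w u₀ u) ∧
        ∀ u : ℤ × ℤ → ℝ, Inpainting.IsInpainted method N r A w u₀ u →
          ∀ p : ℝ≥0∞, 0 < p →
            Inpainting.discreteNorm N p
              (fun z => u₀ (Inpainting.transport (Inpainting.lineAngle g)
                ((z.1 : ℝ) / N, (z.2 : ℝ) / N)) - u z)
            ≤ K (r / |g.2|) (Inpainting.lineAngle g) *
                (r * (1 / (N : ℝ))) ^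
                  (min (min (s' / 2 + (p⁻¹).toReal / 2) (s / 2)) 1) := by
  choose k hk using fun n : ℕ ↦ Inpainting.exists_error_bound hδ hL hs' hss' hx hx01 hper hglobal
    hlocal (le_add_of_nonneg_left n.cast_nonneg : (1 : ℝ) ≤ n + 1)
  obtain ⟨K, hcont, hmono, hblowup, hK⟩ := Inpainting.exists_error_constant k
  refine ⟨K, hcont, hmono, hblowup, ?_⟩
  rintro method r hr N hN hNδ A hA w hw hmass _ rfl hg
  have : NeZero N := ⟨hN.ne'⟩
  have hS := Inpainting.admissible_stencil method hr hA hw hmass hg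
  refine ⟨Inpainting.existsUnique_isInpainted hS hper, fun u hu p hp ↦ ?_⟩
  set ρ := r / |(Inpainting.centerOfMass method r A w).2|
  have ρ_le : ρ ≤ ⌈ρ⌉₊ + 1 := (Nat.le_ceil ρ).trans (by linarith)
  have hrδ := Inpainting.mul_le_of_lt_div_add_two hr (by positivity) hNδ
  refine (hk ⌈ρ⌉₊ method r N A w u hS hrδ ρ_le hu p hp).trans ?_
  gcongr
  exact hK ρ _ (Inpainting.lineAngle_mem_Ico _)
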